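/- Consider a system of $n$ subsystems with Hilbert space $\mathcal H=\bigotimes_{a=1}^n\mathcal H_a$, $\dim\mathcal H_a<\infty$. A *neighborhood structure* $\mathcal N=\{\mathcal N_j\}$ is a set of proper subsets of $\{1,\dots,n\}$ (*neighborhoods*) whose union is $\{1,\dots,n\}$. Two subsystems belong to the same *coarse-grained subsystem* if they are contained in exactly the same neighborhoods. $\mathcal N$ satisfies *matching overlap* if, for every set of neighborhoods with nonempty common intersection, this common intersection equals the intersection of any two distinct members of the set. A *cycle* consists of $m\ge 2$ distinct neighborhoods $\mathcal N_{k(1)},\dots,\mathcal N_{k(m)}$ and subsystems $j(0),\dots,j(m)$ with $j(0)=j(m)$, such that $j(\ell-1),j(\ell)\in\mathcal N_{k(\ell)}$ for $1\le\ell\le m$, and $j(1),\dots,j(m)$ belong to pairwise distinct coarse-grained subsystems. $\mathcal N$ is *tree-like* if it satisfies matching overlap and has no cycle. A *neighborhood map* is a completely positive trace-preserving map on $\mathcal B(\mathcal H)$ of the form $\mathcal E(X)=\sum_i (M_i\otimes I)X(M_i\otimes I)^\dagger$ with all $M_i$ acting on the subsystems of one neighborhood $\mathcal N_j$ and $I$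 the identity on the others. A density operator $\rho$ is *robustly finite-time stabilizable* (RFTS) with respect to $\mathcal N$ if there is a finite sequence $\mathcal E_1,\dots,\mathcal E_T$ of neighborhood maps with $\mathcal E_t(\rho)=\rho$ for all $t$ and such that, for every permutation $\pi$ of $\{1,\dots,T\}$ and every density operator $\sigma$, $(\mathcal E_{\pi(1)}\circ\dots\circ\mathcal E_{\pi(T)})(\sigma)=\rho$. For a unit vector $|\psi\rangle\in\mathcal H$, let $\Pi_j=\Pi_{\mathcal N_j}\otimes I$, where $\Pi_{\mathcal N_j}$ is the orthogonal projection onto the Schmidt span of $|\psi\rangle$ on $\mathcal N_j$, i.e. the span of the vectors $|a_i\rangle$ in a Schmidt decomposition $|\psi\rangle=\sum_i|a_i\rangle\otimes|b_i\rangle$ between $\mathcal N_j$ and its complement (equivalently, the support of the reduced state of $|\psi\rangle\langle\psi|$ on $\mathcal N_j$). The *canonical frustration-free parent Hamiltonian* of $|\psi\rangle$ is $H_{|\psi\rangle}=\sum_j(I-\Pi_j)$; it is called *commuting* if $[\Pi_j,\Pi_k]=0$ for all $j,k$. **Corollary.** Let $\mathcal N$ be a tree-like neighborhood structure. A pure state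 $|\psi\rangle\langle\psi|$ is RFTS with respect to $\mathcal N$ if and only if $|\psi\rangle$ is, up to a scalar factor, the unique ground state of $H_{|\psi\rangle}$ and $H_{|\psi\rangle}$ is commuting. -/

import Mathlib

open scoped Matrix Kronecker ComplexOrder

namespace QL

noncomputable section

variable {n : ℕ}

/-! ### Multipartite systems -/

/-- Labels of the product basis of `⨂ a, ℂ^(d a)`. -/
abbrev Config (d : Fin n → ℕ) : Type := (a : Fin n) → Fin (d a)

/-- Labels of the product basis of `⨂ a ∈ S, ℂ^(d a)`. -/
abbrev InConfig (d : Fin n → ℕ) (S : Finset (Fin n)) : Type :=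
  (a : {a : Fin n // a ∈ S}) → Fin (d a)

/-- Labels of the product basis of `⨂ a ∉ S, ℂ^(d a)`. -/
abbrev OutConfig (d : Fin n → ℕ) (S : Finset (Fin n)) : Type :=
  (a : {a : Fin n // a ∉ S}) → Fin (d a)

/-- The Hilbert space `⨂ a, ℂ^(d a)` of `n` subsystems, the `a`-th one of dimension `d a`. -/
abbrev Hilb (d : Fin n → ℕ) : Type := EuclideanSpace ℂ (Config d)

/-- The linear operators on `⨂ a, ℂ^(d a)`, as matrices in the product basis. -/
abbrev Op (d : Fin n → ℕ) : Type := Matrix (Config d) (Config d) ℂ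

/-- The bipartition of the system into `S` and its complement. -/
def split (d : Fin n → ℕ) (S : Finset (Fin n)) :
    Config d ≃ InConfig d S × OutConfig d S :=
  Equiv.piEquivPiSubtypeProd (fun a => a ∈ S) (fun a => Fin (d a))

/-- The operator `A ⊗ I` on the whole system, where `A` acts on the subsystems in `S`. -/
def extend {d : Fin n → ℕ} (S : Finset (Fin n))
    (A : Matrix (InConfig d S) (InConfig d S) ℂ) : Op d :=
  (A ⊗ₖ (1 : Matrix (OutConfig d S) (OutConfig d S) ℂ)).submatrix (split d S) (split d S)

/-- Density operators. -/
def IsDensity {d : Fin n → ℕ} (ρ : Op d) : Prop :=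
  ρ.PosSemidef ∧ ρ.trace = 1

/-- The operator `|ψ⟩⟨ψ|`. -/
def pureState {d : Fin n → ℕ} (ψ : Hilb d) : Op d :=
  Matrix.of fun x y => ψ x * star (ψ y)

/-- The real number `⟨φ|A|φ⟩` (its real part, for a general operator `A`). -/
def energy {d : Fin n → ℕ} (A : Op d) (φ : Hilb d) : ℝ :=
  (inner ℂ φ (Matrix.toEuclideanCLM (𝕜 := ℂ) A φ)).re

/-! ### Neighborhood structures -/

/-- A neighborhood structure on `n` subsystems: a hypergraph whose hyperedges are proper subsets
of the set of subsystems, and in which each subsystem belongs to some hyperedge. -/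
structure NeighborhoodStructure (n : ℕ) where
  nbhds : Finset (Finset (Fin n))
  proper : ∀ S ∈ nbhds, S ⊂ Finset.univ
  covers : ∀ a : Fin n, ∃ S ∈ nbhds, a ∈ S

namespace NeighborhoodStructure

variable (N : NeighborhoodStructure n)

/-- Two subsystems belong to the same coarse-grained subsystem: they are contained in exactly the
same neighborhoods. -/
def SameParticle (a b : Fin n) : Prop :=
  ∀ S ∈ N.nbhds, a ∈ S ↔ b ∈ S

/-- Matching overlap: whenever a set of neighborhoods has a nonempty common intersection, this is
the intersection of any two distinct members of the set. -/
def MatchingOverlap : Prop :=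
  ∀ F ⊆ N.nbhds, (F.inf id).Nonempty → ∀ S ∈ F, ∀ T ∈ F, S ≠ T → S ∩ T = F.inf id

/-- A path `j 0, k 0, j 1, k 1, …, k (m - 1), j m` of subsystems and neighborhoods: the
neighborhoods are distinct, consecutive subsystems lie in the neighborhood between them, and the
subsystems belong to distinct coarse-grained subsystems, with the possible exception of the two
ends. -/
structure IsPath {m : ℕ} (j : Fin (m + 1) → Fin n) (k : Fin m → Finset (Fin n)) : Prop where
  nbhd_mem : ∀ l, k l ∈ N.nbhds
  nbhd_injective : Function.Injective k
  left_mem : ∀ l : Fin m, j l.castSucc ∈ k l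
  right_mem : ∀ l : Fin m, j l.succ ∈ k l
  distinct : ∀ l l' : Fin (m + 1), l < l' → ¬ (l = 0 ∧ l' = Fin.last m) →
    ¬ N.SameParticle (j l) (j l')

/-- A cycle: a closed path. The degenerate closed path `j 0, k 0, j 0` with a single neighborhood
is not a cycle. -/
def IsCycle {m : ℕ} (j : Fin (m + 1) → Fin n) (k : Fin m → Finset (Fin n)) : Prop :=
  2 ≤ m ∧ N.IsPath j k ∧ j 0 = j (Fin.last m)

/-- Tree-like neighborhood structures: matching overlap and no cycles. -/
def IsTreeLike : Prop :=
  N.MatchingOverlap ∧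
    ∀ (m : ℕ) (j : Fin (m + 1) → Fin n) (k : Fin m → Finset (Fin n)), ¬ N.IsCycle j k

end NeighborhoodStructure

/-! ### Neighborhood maps and robust finite-time stabilizability -/

/-- `E` is a completely positive trace-preserving map of the form `E_S ⊗ id`: it has an operator
sum representation with Kraus operators of the form `M ⊗ I`, with `M` acting on the subsystems
in `S`. -/
def IsNeighborhoodMap {d : Fin n → ℕ} (S : Finset (Fin n)) (E : Module.End ℂ (Op d)) : Prop :=
  ∃ (r : ℕ) (M : Fin r → Matrix (InConfig d S) (InConfig d S) ℂ),
    (∀ X : Op d, E X = ∑ i, extend S (M i) * X * (extend S (M i))ᴴ) ∧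
    ∑ i, (extend S (M i))ᴴ * extend S (M i) = (1 : Op d)

/-- `ρ` is robustly finite-time stabilizable: there are finitely many CPTP neighborhood maps, each
leaving `ρ` invariant, whose composition in any order sends every density operator to `ρ`.
(The product in `Module.End` is composition.) -/
def NeighborhoodStructure.IsRFTS (N : NeighborhoodStructure n) {d : Fin n → ℕ} (ρ : Op d) : Prop :=
  ∃ (T : ℕ) (E : Fin T → Module.End ℂ (Op d)),
    (∀ t, ∃ S ∈ N.nbhds, IsNeighborhoodMap S (E t)) ∧
    (∀ t, E t ρ = ρ) ∧
    ∀ π : Equiv.Perm (Fin T), ∀ σ : Op d, IsDensity σ →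
      (List.ofFn fun t => E (π t)).prod σ = ρ

/-! ### The canonical parent Hamiltonian -/

/-- The Schmidt span of `ψ` on the subsystems in `S`: the span of the vectors `(I ⊗ ⟨z|) ψ`, where
`z` runs through the product basis of the complement. It is the span of the vectors `a_i` in any
Schmidt decomposition `ψ = ∑ a_i ⊗ b_i`, and the support of the reduced state on `S`. -/
def schmidtSpan {d : Fin n → ℕ} (S : Finset (Fin n)) (ψ : Hilb d) :
    Submodule ℂ (EuclideanSpace ℂ (InConfig d S)) :=
  Submodule.span ℂ (Set.range fun z : OutConfig d S =>
    WithLp.toLp 2 fun x : InConfig d S => ψ ((split d S).symm (x, z)))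

/-- The operator `Π_S ⊗ I`, with `Π_S` the orthogonal projection onto the Schmidt span of `ψ`
on `S`. -/
def nbhdProj {d : Fin n → ℕ} (S : Finset (Fin n)) (ψ : Hilb d) : Op d :=
  extend S ((Matrix.toEuclideanCLM (𝕜 := ℂ)).symm (schmidtSpan S ψ).starProjection)

/-- The canonical parent Hamiltonian `∑ j, (I - Π_j)`. -/
def NeighborhoodStructure.canonicalHamiltonian (N : NeighborhoodStructure n) {d : Fin n → ℕ}
    (ψ : Hilb d) : Op d :=
  ∑ S ∈ N.nbhds, (1 - nbhdProj S ψ)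

/-- The canonical parent Hamiltonian is commuting: its defining projectors commute pairwise. -/
def NeighborhoodStructure.HasCommutingHamiltonian (N : NeighborhoodStructure n) {d : Fin n → ℕ}
    (ψ : Hilb d) : Prop :=
  ∀ S ∈ N.nbhds, ∀ T ∈ N.nbhds, Commute (nbhdProj S ψ) (nbhdProj T ψ)

/-- `φ` is a ground state of `A`: a unit vector that minimizes the energy among unit vectors. -/
def IsGroundState {d : Fin n → ℕ} (A : Op d) (φ : Hilb d) : Prop :=
  ‖φ‖ = 1 ∧ ∀ χ : Hilb d, ‖χ‖ = 1 → energy A φ ≤ energy A χ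

/-- `ψ` is the unique ground state of `A`, up to a scalar factor. -/
def IsUniqueGroundState {d : Fin n → ℕ} (A : Op d) (ψ : Hilb d) : Prop :=
  IsGroundState A ψ ∧ ∀ φ : Hilb d, IsGroundState A φ → ∃ c : ℂ, φ = c • ψ

/-! ### The canonical parent Hamiltonian is frustration-free -/

theorem extend_mul {d : Fin n → ℕ} (S : Finset (Fin n)) (A B : Matrix (InConfig d S) (InConfig d S) ℂ) :
    extend S A * extend S B = extend S (A * B) := by
  unfold extend
  rw [Matrix.submatrix_mul_equiv, ← Matrix.mul_kronecker_mul, one_mul]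

theorem extend_conjTranspose {d : Fin n → ℕ} (S : Finset (Fin n)) (A : Matrix (InConfig d S) (InConfig d S) ℂ) :
    (extend S A)ᴴ = extend S Aᴴ := by
  unfold extend
  rw [Matrix.conjTranspose_submatrix, Matrix.conjTranspose_kronecker, Matrix.conjTranspose_one]

theorem extend_apply {d : Fin n → ℕ} (S : Finset (Fin n)) (A : Matrix (InConfig d S) (InConfig d S) ℂ)
    (φ : Hilb d) (x : InConfig d S) (z : OutConfig d S) :
    Matrix.toEuclideanCLM (𝕜 := ℂ) (extend S A) φ ((split d S).symm (x, z)) =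
      ∑ x', A x x' * φ ((split d S).symm (x', z)) := by
  simp only [Matrix.ofLp_toEuclideanCLM, Matrix.mulVec, dotProduct]
  rw [← (split d S).symm.sum_comp, Fintype.sum_prod_type]
  simp [extend, Matrix.one_apply]

theorem nbhdProj_self {d : Fin n → ℕ} (S : Finset (Fin n)) (ψ : Hilb d) :
    Matrix.toEuclideanCLM (𝕜 := ℂ) (nbhdProj S ψ) ψ = ψ := by
  ext c
  obtain ⟨⟨x, z⟩, rfl⟩ := (split d S).symm.surjective c
  rw [nbhdProj, extend_apply]
  set v : EuclideanSpace ℂ (InConfig d S) :=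
    WithLp.toLp 2 fun x : InConfig d S => ψ ((split d S).symm (x, z)) with hv
  have hmem : v ∈ schmidtSpan S ψ := Submodule.subset_span ⟨z, rfl⟩
  have h := Submodule.starProjection_eq_self_iff.2 hmem
  have h2 := congrArg (fun f => f v x)
    ((Matrix.toEuclideanCLM (n := InConfig d S) (𝕜 := ℂ)).apply_symm_apply (schmidtSpan S ψ).starProjection)
  simp only [h] at h2
  rw [Matrix.ofLp_toEuclideanCLM] at h2
  exact h2

theorem isStarProjection_nbhdProj {d : Fin n → ℕ} (S : Finset (Fin n)) (ψ : Hilb d) : IsStarProjection (nbhdProj S ψ) := by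
  have h : IsStarProjection (schmidtSpan S ψ).starProjection := isStarProjection_starProjection
  constructor
  · have := h.isIdempotentElem
    unfold IsIdempotentElem at *
    rw [nbhdProj, extend_mul, ← map_mul, this]
  · have := h.isSelfAdjoint
    unfold IsSelfAdjoint at *
    rw [Matrix.star_eq_conjTranspose]
    rw [nbhdProj, extend_conjTranspose, ← Matrix.star_eq_conjTranspose]
    congr 1
    refine (map_star (Matrix.toEuclideanCLM (n := InConfig d S) (𝕜 := ℂ)).symm _).symm.trans ?_
    rw [this]

theorem energy_nonneg {d : Fin n → ℕ} (S : Finset (Fin n)) (ψ φ : Hilb d) : 0 ≤ energy (1 - nbhdProj S ψ) φ := by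
  have h := ((isStarProjection_nbhdProj S ψ).one_sub.map (Matrix.toEuclideanCLM (n := Config d) (𝕜 := ℂ)))
  set Q := Matrix.toEuclideanCLM (n := Config d) (𝕜 := ℂ) (1 - nbhdProj S ψ) with hQ
  have h1 : Q = ContinuousLinearMap.adjoint Q * Q := by
    have := h.isSelfAdjoint
    unfold IsSelfAdjoint at this
    rw [← ContinuousLinearMap.star_eq_adjoint, this, h.isIdempotentElem]
  unfold energy
  rw [← hQ, h1]
  change 0 ≤ (inner ℂ φ ((ContinuousLinearMap.adjoint Q) (Q φ))).re
  rw [ContinuousLinearMap.adjoint_inner_right]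
  exact inner_self_nonneg (𝕜 := ℂ)

theorem energy_sum {d : Fin n → ℕ} (N : NeighborhoodStructure n) (ψ φ : Hilb d) :
    energy (N.canonicalHamiltonian ψ) φ = ∑ S ∈ N.nbhds, energy (1 - nbhdProj S ψ) φ := by
  unfold energy NeighborhoodStructure.canonicalHamiltonian
  rw [map_sum, sum_apply, inner_sum, Complex.re_sum]

theorem energy_self {d : Fin n → ℕ} (S : Finset (Fin n)) (ψ : Hilb d) : energy (1 - nbhdProj S ψ) ψ = 0 := by
  simp [energy, map_sub, nbhdProj_self]

/-- The canonical parent Hamiltonian deserves its name: `ψ` is one of its ground states, and it is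
frustration-free, that is, its ground states are ground states of all its terms `I - Π_j`. -/
theorem canonicalHamiltonian_frustrationFree {d : Fin n → ℕ}
    (N : NeighborhoodStructure n) (ψ : Hilb d) (hψ : ‖ψ‖ = 1) :
    IsGroundState (N.canonicalHamiltonian ψ) ψ ∧
      ∀ φ, IsGroundState (N.canonicalHamiltonian ψ) φ →
        ∀ S ∈ N.nbhds, IsGroundState (1 - nbhdProj S ψ) φ := by
  constructor
  · refine ⟨hψ, fun χ _ => ?_⟩
    rw [energy_sum, energy_sum, Finset.sum_eq_zero fun S _ => energy_self S ψ]
    exact Finset.sum_nonneg fun S _ => energy_nonneg S ψ χ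
  · rintro φ ⟨h1, h2⟩ S hS
    have h := h2 ψ hψ
    rw [energy_sum, energy_sum, Finset.sum_eq_zero fun S _ => energy_self S ψ] at h
    have h0 : energy (1 - nbhdProj S ψ) φ ≤ 0 :=
      (Finset.single_le_sum (fun T _ => energy_nonneg T ψ φ) hS).trans h
    exact ⟨h1, fun χ _ => h0.trans (energy_nonneg S ψ χ)⟩

end

end QL

open scoped Matrix Kronecker ComplexOrder

namespace QL

variable {n : ℕ} {d : Fin n → ℕ}

/-! ### Local operators -/

/-! The range of `Π_S` consists of the vectors `Zψ` with `Z` acting outside `S`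
(`nbhdProj_mulVec_eq_self_iff`). Tree-likeness is used as a separation property
(`exists_separates`): around a coarse-grained subsystem `p` of `S` the system splits as `A ∪ p ∪ C`,
where `S` lies in `A ∪ p`, the other neighborhoods of `p` lie in `p ∪ C`, and every neighborhood
lies on one of the two sides. Both directions pass through the absence of correlations between `A`
and `C` in `ψ` (`Clusters`).

From stabilizability: a neighborhood map fixing `ψ` has Kraus operators with eigenvector `ψ`, so it
fixes every pure state in the range of its `Π_S`; a second ground state would never be moved. For
clustering, start from `Zψ` with `Z` on `C` and let the maps inside `A ∪ p` act first: they do not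
see `Z`. The remaining maps do not touch `A`. The outcome is `ψ`, so the statistics on `A` were
those of `ψ` from the start. Clustering then makes `Π_T` preserve the range of `Π_S`, so the two
commute (`Clusters.commute`).

Conversely, commuting projections and a unique ground state give clustering (`clusters_of_commute`).
The reduced state on `A ∪ C` is then a product, so the support of `ψ` on `p` factors into two
virtual subsystems, one correlated only with `A` and one only with `C` (`exists_isVirtualBasis`).
Resetting all the virtual subsystems of `S` of the first kind to a suitable joint vector brings
every state into the range of `Π_S` and leaves the ranges of the other projections invariant
(`HasCooling.exists_kraus`). One such map per neighborhood, in any order, reaches the intersection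
of all the ranges, which is spanned by `ψ`. -/

/-- The restriction of a configuration to the subsystems in `S`. -/
def restr (S : Finset (Fin n)) (x : Config d) : InConfig d S := fun a => x a

/-- The configuration that agrees with `u` on `S` and with `x` elsewhere. -/
def override (S : Finset (Fin n)) (x : Config d) (u : InConfig d S) : Config d :=
  fun a => if h : a ∈ S then u ⟨a, h⟩ else x a

theorem override_restr (S : Finset (Fin n)) (x : Config d) : override S x (restr S x) = x := by
  funext a
  simp [restr, override]

theorem restr_override_of_disjoint {S T : Finset (Fin n)} (h : Disjoint S T) (x : Config d)
    (u : InConfig d S) : restr T (override S x u) = restr T x := by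
  funext a
  simp [restr, override, Finset.disjoint_right.1 h a.2]

theorem override_comm {S T : Finset (Fin n)} (h : Disjoint S T) (x : Config d)
    (u : InConfig d S) (v : InConfig d T) :
    override T (override S x u) v = override S (override T x v) u := by
  funext a
  by_cases hS : a ∈ S
  · simp [override, hS, Finset.disjoint_left.1 h hS]
  · simp [override, hS]

/-- On functions, `A ⊗ I` only rewrites the coordinates in `S`; identities between local operators
thus reduce to identities between `override`s. -/
theorem extend_mulVec (S : Finset (Fin n)) (A : Matrix (InConfig d S) (InConfig d S) ℂ)
    (f : Config d → ℂ) (x : Config d) :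
    (extend S A *ᵥ f) x = ∑ u, A (restr S x) u * f (override S x u) := by
  have h := extend_apply S A (WithLp.toLp 2 f) (restr S x) (fun a => x a)
  simp only [Matrix.ofLp_toEuclideanCLM] at h
  have e : ∀ u, (split d S).symm (u, fun a => x a) = override S x u := fun u => rfl
  simpa only [e, override_restr] using h

theorem ext_mulVec {X Y : Op d} (h : ∀ f x, (X *ᵥ f) x = (Y *ᵥ f) x) : X = Y :=
  Matrix.ext_of_mulVec_single fun _ => funext fun x => h _ x

theorem extend_one (S : Finset (Fin n)) :
    extend S (1 : Matrix (InConfig d S) (InConfig d S) ℂ) = 1 := by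
  simp [extend]

theorem extend_add (S : Finset (Fin n)) (A B : Matrix (InConfig d S) (InConfig d S) ℂ) :
    extend S (A + B) = extend S A + extend S B := by
  rw [extend, Matrix.add_kronecker]
  rfl

theorem extend_smul (S : Finset (Fin n)) (c : ℂ) (A : Matrix (InConfig d S) (InConfig d S) ℂ) :
    extend S (c • A) = c • extend S A := by
  rw [extend, Matrix.smul_kronecker]
  rfl

theorem extend_sum {ι : Type*} (s : Finset ι) (S : Finset (Fin n))
    (A : ι → Matrix (InConfig d S) (InConfig d S) ℂ) :
    extend S (∑ i ∈ s, A i) = ∑ i ∈ s, extend S (A i) :=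
  map_sum (AddMonoidHom.mk' (extend S) (extend_add S)) A s

/-- The algebra of the operators that act on the subsystems in `S`. -/
def localOps (d : Fin n → ℕ) (S : Finset (Fin n)) : StarSubalgebra ℂ (Op d) where
  carrier := Set.range (extend S)
  mul_mem' := by
    rintro _ _ ⟨A, rfl⟩ ⟨B, rfl⟩
    exact ⟨A * B, (extend_mul S A B).symm⟩
  add_mem' := by
    rintro _ _ ⟨A, rfl⟩ ⟨B, rfl⟩
    exact ⟨A + B, extend_add S A B⟩
  algebraMap_mem' c := ⟨c • 1, by rw [extend_smul, extend_one, Algebra.algebraMap_eq_smul_one]⟩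
  star_mem' := by
    rintro _ ⟨A, rfl⟩
    exact ⟨Aᴴ, (extend_conjTranspose S A).symm⟩

theorem extend_mem_localOps (S : Finset (Fin n)) (A : Matrix (InConfig d S) (InConfig d S) ℂ) :
    extend S A ∈ localOps d S := ⟨A, rfl⟩

theorem localOps_commute {S T : Finset (Fin n)} (h : Disjoint S T) {X Y : Op d}
    (hX : X ∈ localOps d S) (hY : Y ∈ localOps d T) : X * Y = Y * X := by
  obtain ⟨A, rfl⟩ := hX
  obtain ⟨B, rfl⟩ := hY
  refine ext_mulVec fun f x => ?_
  simp only [← Matrix.mulVec_mulVec, extend_mulVec, restr_override_of_disjoint h,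
    restr_override_of_disjoint h.symm, Finset.mul_sum]
  rw [Finset.sum_comm]
  refine Finset.sum_congr rfl fun u _ => Finset.sum_congr rfl fun v _ => ?_
  rw [override_comm h]
  ring

theorem extend_single_mulVec (S : Finset (Fin n)) (u v : InConfig d S) (f : Config d → ℂ)
    (x : Config d) :
    (extend S (Matrix.single u v 1) *ᵥ f) x = if restr S x = u then f (override S x v) else 0 := by
  rw [extend_mulVec]
  by_cases h : restr S x = u
  · simp [Matrix.single_apply, h]
  · simp [h, Ne.symm h]

theorem extend_eq_sum_single (S : Finset (Fin n)) (A : Matrix (InConfig d S) (InConfig d S) ℂ) :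
    extend S A = ∑ u, ∑ v, A u v • extend S (Matrix.single u v 1) := by
  conv_lhs => rw [Matrix.matrix_eq_sum_single A]
  simp only [extend_sum, ← extend_smul, Matrix.smul_single, smul_eq_mul, mul_one]

/-- Matrix units span, and a matrix unit on `S ∪ T` is the product of one on `S` and one on `T`.
Linear claims about operators on the union can therefore be checked on products. -/
theorem localOps_union {S T : Finset (Fin n)} (h : Disjoint S T) {X : Op d}
    (hX : X ∈ localOps d (S ∪ T)) :
    X ∈ Submodule.span ℂ {Z | ∃ A ∈ localOps d S, ∃ B ∈ localOps d T, Z = A * B} := by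
  obtain ⟨A, rfl⟩ := hX
  rw [extend_eq_sum_single]
  refine Submodule.sum_mem _ fun u _ => Submodule.sum_mem _ fun v _ =>
    Submodule.smul_mem _ _ (Submodule.subset_span ?_)
  refine ⟨extend S (Matrix.single (fun a => u ⟨a, Finset.mem_union_left _ a.2⟩)
      (fun a => v ⟨a, Finset.mem_union_left _ a.2⟩) 1), extend_mem_localOps _ _,
    extend T (Matrix.single (fun a => u ⟨a, Finset.mem_union_right _ a.2⟩)
      (fun a => v ⟨a, Finset.mem_union_right _ a.2⟩) 1), extend_mem_localOps _ _, ?_⟩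
  refine ext_mulVec fun f x => ?_
  rw [← Matrix.mulVec_mulVec, extend_single_mulVec, extend_single_mulVec, extend_single_mulVec,
    restr_override_of_disjoint h, ← ite_and]
  congr 1
  · simp only [restr, funext_iff, Subtype.forall, Finset.mem_union, eq_iff_iff]
    constructor
    · exact fun H => ⟨fun a ha => H a (Or.inl ha), fun a ha => H a (Or.inr ha)⟩
    · rintro ⟨H1, H2⟩ a (ha | ha)
      exacts [H1 a ha, H2 a ha]
  · congr 1
    funext a
    by_cases hS : a ∈ S <;> by_cases hT : a ∈ T <;> simp [override, hS, hT]

theorem localOps_mono {S T : Finset (Fin n)} (h : S ⊆ T) : localOps d S ≤ localOps d T := by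
  rintro _ ⟨A, rfl⟩
  -- The tensor product of `A` with the identity on `T \ S`.
  refine ⟨Matrix.of fun u v => if ∀ a (ha : a ∈ T), a ∉ S → u ⟨a, ha⟩ = v ⟨a, ha⟩ then
    A (fun a => u ⟨a, h a.2⟩) (fun a => v ⟨a, h a.2⟩) else 0, ?_⟩
  ext x y
  simp only [extend, Matrix.submatrix_apply, split, Equiv.piEquivPiSubtypeProd_apply,
    Matrix.kroneckerMap_apply, Matrix.one_apply, Matrix.of_apply]
  simp only [funext_iff, Subtype.forall, mul_ite, mul_one, mul_zero, ← ite_and]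
  congr 1
  simp only [eq_iff_iff]
  constructor
  · rintro ⟨H1, H2⟩ a ha
    by_cases hT : a ∈ T
    exacts [H2 a hT ha, H1 a hT]
  · exact fun H => ⟨fun a ha => H a fun h' => ha (h h'), fun a _ ha => H a ha⟩

theorem localOps_empty {X : Op d} (hX : X ∈ localOps d ∅) : ∃ c : ℂ, X = c • 1 := by
  obtain ⟨A, rfl⟩ := hX
  refine ⟨A (fun a => absurd a.2 (Finset.notMem_empty _)) (fun a => absurd a.2 (Finset.notMem_empty _)), ?_⟩
  rw [← extend_one ∅, ← extend_smul]
  congr 1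
  ext u v
  rw [Subsingleton.elim u (fun a => absurd a.2 (Finset.notMem_empty _)),
    Subsingleton.elim v (fun a => absurd a.2 (Finset.notMem_empty _))]
  simp

/-! ### The projections onto the Schmidt spans -/

theorem nbhdProj_mem (S : Finset (Fin n)) (ψ : Hilb d) : nbhdProj S ψ ∈ localOps d S := ⟨_, rfl⟩

theorem nbhdProj_mulVec_self (S : Finset (Fin n)) (ψ : Hilb d) :
    nbhdProj S ψ *ᵥ ψ.ofLp = ψ.ofLp := by
  rw [← Matrix.ofLp_toEuclideanCLM (𝕜 := ℂ), nbhdProj_self]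

theorem nbhdProj_mul_self (S : Finset (Fin n)) (ψ : Hilb d) :
    nbhdProj S ψ * nbhdProj S ψ = nbhdProj S ψ := (isStarProjection_nbhdProj S ψ).isIdempotentElem

theorem nbhdProj_conjTranspose (S : Finset (Fin n)) (ψ : Hilb d) :
    (nbhdProj S ψ)ᴴ = nbhdProj S ψ := (isStarProjection_nbhdProj S ψ).isSelfAdjoint

theorem localOps_mulVec_comm {S T : Finset (Fin n)} (h : Disjoint S T) {X Y : Op d}
    (hX : X ∈ localOps d S) (hY : Y ∈ localOps d T) (f : Config d → ℂ) :
    X *ᵥ (Y *ᵥ f) = Y *ᵥ (X *ᵥ f) := by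
  rw [Matrix.mulVec_mulVec, localOps_commute h hX hY, Matrix.mulVec_mulVec]

/-- The range of `Π_S` consists of the vectors obtained from `ψ` by acting outside `S`. -/
theorem nbhdProj_mulVec_eq_self_iff (S : Finset (Fin n)) (ψ : Hilb d) (f : Config d → ℂ) :
    nbhdProj S ψ *ᵥ f = f ↔ ∃ Z ∈ localOps d Sᶜ, f = Z *ᵥ ψ.ofLp := by
  constructor
  · intro h
    -- Every slice of `f` at fixed outside labels is a combination of slices of `ψ`; the
    -- coefficients will be the matrix of `Z`.
    have hmem : ∀ z : OutConfig d S, (WithLp.toLp 2 fun x : InConfig d S =>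
        f ((split d S).symm (x, z))) ∈ schmidtSpan S ψ := by
      intro z
      set v : EuclideanSpace ℂ (InConfig d S) :=
        WithLp.toLp 2 fun x : InConfig d S => f ((split d S).symm (x, z)) with hv
      rw [← Submodule.starProjection_eq_self_iff]
      ext x
      have h1 : f ((split d S).symm (x, z)) = (nbhdProj S ψ *ᵥ f) ((split d S).symm (x, z)) := by
        rw [h]
      have h2 := extend_apply S ((Matrix.toEuclideanCLM (𝕜 := ℂ)).symm
        (schmidtSpan S ψ).starProjection) (WithLp.toLp 2 f) x z
      rw [Matrix.ofLp_toEuclideanCLM] at h2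
      have h3 : v x = f ((split d S).symm (x, z)) := rfl
      rw [h3, h1]
      refine Eq.trans ?_ h2.symm
      have h4 := congrArg (fun g => g v x)
        ((Matrix.toEuclideanCLM (n := InConfig d S) (𝕜 := ℂ)).apply_symm_apply
          (schmidtSpan S ψ).starProjection)
      simp only at h4
      rw [← h4, Matrix.ofLp_toEuclideanCLM]
      rfl
    have hc : ∀ z : OutConfig d S, ∃ c : OutConfig d S → ℂ, ∀ x : InConfig d S,
        f ((split d S).symm (x, z)) = ∑ w, c w * ψ ((split d S).symm (x, w)) := by
      intro z
      obtain ⟨c, hc⟩ := (Submodule.mem_span_range_iff_exists_fun ℂ).1 (hmem z)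
      refine ⟨c, fun x => ?_⟩
      have := congrArg (fun g => g x) hc
      simp only [WithLp.ofLp_sum, WithLp.ofLp_smul, Finset.sum_apply, Pi.smul_apply,
        smul_eq_mul] at this
      exact this.symm
    choose c hc using hc
    let toOut : InConfig d Sᶜ → OutConfig d S := fun u a => u ⟨a, Finset.mem_compl.2 a.2⟩
    let toIn : OutConfig d S → InConfig d Sᶜ := fun u a => u ⟨a, Finset.mem_compl.1 a.2⟩
    refine ⟨extend Sᶜ (Matrix.of fun u v => c (toOut u) (toOut v)), extend_mem_localOps _ _, ?_⟩
    funext y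
    obtain ⟨⟨x, z⟩, rfl⟩ := (split d S).symm.surjective y
    rw [hc, extend_mulVec]
    refine Fintype.sum_equiv ⟨toIn, toOut, fun _ => rfl, fun _ => rfl⟩ _ _ fun w => ?_
    congr 1
    · simp only [Matrix.of_apply, Equiv.coe_fn_mk]
      congr 1
      funext a
      have : (a : Fin n) ∉ S := a.2
      simp [toOut, restr, split, Equiv.piEquivPiSubtypeProd, this]
    · refine congrArg ψ.ofLp (funext fun a => ?_)
      by_cases h : a ∈ S <;> simp [override, split, Equiv.piEquivPiSubtypeProd, h, toIn]
  · rintro ⟨Z, hZ, rfl⟩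
    rw [localOps_mulVec_comm disjoint_compl_right (nbhdProj_mem S ψ) hZ, nbhdProj_mulVec_self]

/-- An operator whose action on `ψ` can be mirrored outside `S` preserves the range of `Π_S`. -/
theorem mul_nbhdProj_of_mirror {S A : Finset (Fin n)} (hA : Disjoint A S) {ψ : Hilb d}
    {X Y : Op d} (hX : X ∈ localOps d S) (hY : Y ∈ localOps d A)
    (hXY : X *ᵥ ψ.ofLp = Y *ᵥ ψ.ofLp) :
    nbhdProj S ψ * (X * nbhdProj S ψ) = X * nbhdProj S ψ := by
  refine ext_mulVec fun f x => congrFun ?_ x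
  rw [← Matrix.mulVec_mulVec, nbhdProj_mulVec_eq_self_iff, ← Matrix.mulVec_mulVec]
  obtain ⟨Z, hZ, h⟩ := (nbhdProj_mulVec_eq_self_iff S ψ (nbhdProj S ψ *ᵥ f)).1
    (by rw [Matrix.mulVec_mulVec, nbhdProj_mul_self])
  -- On a vector `Zψ` of the range, `X Z ψ = Z X ψ = Z Y ψ`, and `Z * Y` acts outside `S`.
  refine ⟨Z * Y, mul_mem hZ (localOps_mono (Finset.subset_compl_iff_disjoint_right.2 hA) hY), ?_⟩
  rw [h, localOps_mulVec_comm disjoint_compl_right hX hZ, hXY, Matrix.mulVec_mulVec]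

theorem mul_nbhdProj_of_disjoint {S A : Finset (Fin n)} (hA : Disjoint A S) {ψ : Hilb d}
    {X : Op d} (hX : X ∈ localOps d A) :
    nbhdProj S ψ * (X * nbhdProj S ψ) = X * nbhdProj S ψ := by
  rw [← mul_assoc, localOps_commute hA.symm (nbhdProj_mem S ψ) hX, mul_assoc, nbhdProj_mul_self]

theorem star_dotProduct_nbhdProj (S : Finset (Fin n)) (ψ : Hilb d) (f g : Config d → ℂ) :
    star f ⬝ᵥ (nbhdProj S ψ *ᵥ g) = star (nbhdProj S ψ *ᵥ f) ⬝ᵥ g := by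
  rw [Matrix.star_mulVec, nbhdProj_conjTranspose, Matrix.dotProduct_mulVec]

/-! ### Ground states as common fixed vectors -/

theorem energy_eq_zero_iff (S : Finset (Fin n)) (ψ φ : Hilb d) :
    energy (1 - nbhdProj S ψ) φ = 0 ↔ nbhdProj S ψ *ᵥ φ.ofLp = φ.ofLp := by
  have key : energy (1 - nbhdProj S ψ) φ =
      ‖Matrix.toEuclideanCLM (n := Config d) (𝕜 := ℂ) (1 - nbhdProj S ψ) φ‖ ^ 2 := by
    have h := ((isStarProjection_nbhdProj S ψ).one_sub.map
      (Matrix.toEuclideanCLM (n := Config d) (𝕜 := ℂ)))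
    set Q := Matrix.toEuclideanCLM (n := Config d) (𝕜 := ℂ) (1 - nbhdProj S ψ) with hQ
    have h1 : Q = ContinuousLinearMap.adjoint Q * Q := by
      have := h.isSelfAdjoint
      unfold IsSelfAdjoint at this
      rw [← ContinuousLinearMap.star_eq_adjoint, this, h.isIdempotentElem]
    unfold energy
    rw [← hQ]
    conv_lhs => rw [h1]
    change (inner ℂ φ ((ContinuousLinearMap.adjoint Q) (Q φ))).re = _
    rw [ContinuousLinearMap.adjoint_inner_right]
    exact inner_self_eq_norm_sq (𝕜 := ℂ) _
  rw [key, sq_eq_zero_iff, norm_eq_zero, ← WithLp.ofLp_eq_zero 2, Matrix.ofLp_toEuclideanCLM,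
    Matrix.sub_mulVec, Matrix.one_mulVec, sub_eq_zero, eq_comm]

/-- The ground states of the canonical parent Hamiltonian are the unit vectors fixed by all
projections. -/
theorem isGroundState_canonicalHamiltonian_iff (N : NeighborhoodStructure n) (ψ : Hilb d)
    (hψ : ‖ψ‖ = 1) (φ : Hilb d) :
    IsGroundState (N.canonicalHamiltonian ψ) φ ↔
      ‖φ‖ = 1 ∧ ∀ S ∈ N.nbhds, nbhdProj S ψ *ᵥ φ.ofLp = φ.ofLp := by
  simp only [← energy_eq_zero_iff]
  constructor
  · intro h
    refine ⟨h.1, fun S hS => le_antisymm ?_ (energy_nonneg S ψ φ)⟩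
    have := ((canonicalHamiltonian_frustrationFree N ψ hψ).2 φ h S hS).2 ψ hψ
    rwa [energy_self] at this
  · rintro ⟨h1, h2⟩
    refine ⟨h1, fun χ _ => ?_⟩
    rw [energy_sum, energy_sum, Finset.sum_eq_zero h2]
    exact Finset.sum_nonneg fun S _ => energy_nonneg S ψ χ

/-- Normalizing a nonzero common fixed vector yields a ground state. Without the norm condition,
uniqueness applies directly to vectors produced by projections or operators. -/
theorem isUniqueGroundState_iff (N : NeighborhoodStructure n) (ψ : Hilb d) (hψ : ‖ψ‖ = 1) :
    IsUniqueGroundState (N.canonicalHamiltonian ψ) ψ ↔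
      ∀ f : Config d → ℂ, (∀ S ∈ N.nbhds, nbhdProj S ψ *ᵥ f = f) → ∃ c : ℂ, f = c • ψ.ofLp := by
  simp only [IsUniqueGroundState, isGroundState_canonicalHamiltonian_iff N ψ hψ]
  constructor
  · rintro ⟨-, h⟩ f hf
    by_cases hf0 : f = 0
    · exact ⟨0, by simp [hf0]⟩
    set φ : Hilb d := WithLp.toLp 2 f with hφ
    have hφ0 : ‖φ‖ ≠ 0 := by
      rw [norm_ne_zero_iff]
      intro h0
      exact hf0 (congrArg WithLp.ofLp h0)
    obtain ⟨c, hc⟩ := h ((‖φ‖ : ℂ)⁻¹ • φ) ⟨by simp [norm_smul, hφ0], fun S hS => by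
      rw [WithLp.ofLp_smul, Matrix.mulVec_smul, hφ, hf S hS]⟩
    refine ⟨(‖φ‖ : ℂ) * c, ?_⟩
    have h1 : φ = ((‖φ‖ : ℂ) * c) • ψ := by
      rw [mul_smul, ← hc, smul_smul, mul_inv_cancel₀ (by exact_mod_cast hφ0), one_smul]
    exact congrArg WithLp.ofLp h1
  · intro h
    refine ⟨⟨hψ, fun S _ => nbhdProj_mulVec_self S ψ⟩, fun φ hφ => ?_⟩
    obtain ⟨c, hc⟩ := h φ.ofLp hφ.2
    exact ⟨c, by ext x; exact congrFun hc x⟩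

theorem star_dotProduct_self (ψ : Hilb d) (hψ : ‖ψ‖ = 1) : star ψ.ofLp ⬝ᵥ ψ.ofLp = 1 := by
  have h := inner_self_eq_norm_sq_to_K (𝕜 := ℂ) ψ
  rw [EuclideanSpace.inner_eq_star_dotProduct, hψ, dotProduct_comm] at h
  simpa using h

theorem pureState_eq (ψ : Hilb d) : pureState ψ = Matrix.vecMulVec ψ.ofLp (star ψ.ofLp) := rfl

/-! ### Tree-like neighborhood structures -/

namespace NeighborhoodStructure

variable (N : NeighborhoodStructure n)

/-- Two distinct subsystems are adjacent if they lie in a common neighborhood other than `S`. -/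
def adjWithout (S : Finset (Fin n)) : SimpleGraph (Fin n) where
  Adj u v := u ≠ v ∧ ∃ T ∈ N.nbhds, T ≠ S ∧ u ∈ T ∧ v ∈ T
  symm := ⟨fun _ _ h => ⟨h.1.symm, by
    obtain ⟨-, T, h1, h2, h3, h4⟩ := h
    exact ⟨T, h1, h2, h4, h3⟩⟩⟩
  loopless := ⟨fun _ h => h.1 rfl⟩

theorem reachable_of_mem {S T : Finset (Fin n)} (hT : T ∈ N.nbhds) (hTS : T ≠ S) {u v : Fin n}
    (hu : u ∈ T) (hv : v ∈ T) : (N.adjWithout S).Reachable u v := by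
  by_cases h : u = v
  · rw [h]
  · have hadj : (N.adjWithout S).Adj u v := ⟨h, T, hT, hTS, hu, hv⟩
    exact hadj.reachable

theorem dist_le_succ_of_mem {S T : Finset (Fin n)} (hT : T ∈ N.nbhds) (hTS : T ≠ S) {a u v : Fin n}
    (hu : u ∈ T) (hv : v ∈ T) :
    (N.adjWithout S).dist a v ≤ (N.adjWithout S).dist a u + 1 := by
  have h := (N.reachable_of_mem hT hTS hu hv).dist_triangle_right a
  have h1 : (N.adjWithout S).dist u v ≤ 1 := by
    by_cases h : u = v
    · simp [h]
    · have hadj : (N.adjWithout S).Adj u v := ⟨h, T, hT, hTS, hu, hv⟩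
      exact (SimpleGraph.dist_eq_one_iff_adj.2 hadj).le
  omega

theorem SameParticle.symm {a b : Fin n} (h : N.SameParticle a b) : N.SameParticle b a :=
  fun S hS => (h S hS).symm

/-- In a tree-like structure, two subsystems of `S` that are connected through other neighborhoods
belong to the same coarse-grained subsystem. -/
theorem IsTreeLike.sameParticle_of_reachable (hN : N.IsTreeLike) {S : Finset (Fin n)}
    (hS : S ∈ N.nbhds) {a x : Fin n} (ha : a ∈ S) (hx : x ∈ S)
    (h : (N.adjWithout S).Reachable a x) : N.SameParticle a x := by
  by_contra hax
  set G := N.adjWithout S with hG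
  -- On a shortest walk the `l`-th vertex is at distance exactly `l` from `a`. Any repetition that
  -- would spoil the cycle gives a shortcut contradicting this.
  obtain ⟨p, hp⟩ := h.exists_walk_length_eq_dist
  set m := p.length with hm
  have hadj : ∀ l, l < m → ∃ T ∈ N.nbhds, T ≠ S ∧ p.getVert l ∈ T ∧ p.getVert (l + 1) ∈ T :=
    fun l hl => (p.adj_getVert_succ hl).2
  have hstep : ∀ l, l < m → G.dist a (p.getVert (l + 1)) ≤ G.dist a (p.getVert l) + 1 := by
    intro l hl
    obtain ⟨T, hT, hTS, h1, h2⟩ := hadj l hl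
    exact N.dist_le_succ_of_mem hT hTS h1 h2
  have hle : ∀ l, l ≤ m → G.dist a (p.getVert l) ≤ l := by
    intro l
    induction l with
    | zero => simp
    | succ l ih =>
      intro hl
      have := hstep l (by omega)
      have := ih (by omega)
      omega
  have hge : ∀ l, l ≤ m → m - l ≤ G.dist a (p.getVert (m - l)) := by
    intro l
    induction l with
    | zero =>
      intro _
      rw [Nat.sub_zero, hm, p.getVert_length, ← hp]
    | succ l ih =>
      intro hl
      have h1 := hstep (m - (l + 1)) (by omega)
      have h2 := ih (by omega)
      rw [show m - (l + 1) + 1 = m - l by omega] at h1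
      omega
  have hdist : ∀ l, l ≤ m → G.dist a (p.getVert l) = l := by
    intro l hl
    have h1 := hge (m - l) (by omega)
    rw [show m - (m - l) = l by omega] at h1
    have := hle l hl
    omega
  have hm0 : 0 < m := by
    rcases Nat.eq_zero_or_pos m with h0 | h0
    · exact absurd (SimpleGraph.Walk.eq_of_length_eq_zero h0) fun h => hax (h ▸ fun _ _ => Iff.rfl)
    · exact h0
  choose! k hk hkS hkl hkr using hadj
  -- The neighborhood following vertex `l'` would also contain vertex `l`. If `l'` is the last
  -- vertex, the neighborhood preceding vertex `l` is used instead, which requires `l ≠ 0`.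
  have hnot : ∀ l l', l < l' → l' ≤ m → ¬ (l = 0 ∧ l' = m) →
      ¬ N.SameParticle (p.getVert l) (p.getVert l') := by
    intro l l' hll hl' hne hsame
    rcases hl'.lt_or_eq with h1 | rfl
    · have h2 := N.dist_le_succ_of_mem (a := a) (hk l' h1) (hkS l' h1)
        ((hsame _ (hk l' h1)).2 (hkl l' h1)) (hkr l' h1)
      rw [← hG, hdist _ (by omega), hdist _ (by omega)] at h2
      omega
    · obtain ⟨l, rfl⟩ : ∃ i, l = i + 1 := ⟨l - 1, by omega⟩
      have h2 := N.dist_le_succ_of_mem (a := a) (hk l (by omega)) (hkS l (by omega))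
        (hkl l (by omega)) ((hsame _ (hk l (by omega))).1 (hkr l (by omega)))
      rw [← hG, hdist _ (by omega), hdist _ (by omega)] at h2
      omega
  have hends : ¬ N.SameParticle (p.getVert 0) (p.getVert m) := by
    simpa [hm] using hax
  have hnot' : ∀ l l', l < l' → l' ≤ m → ¬ N.SameParticle (p.getVert l) (p.getVert l') := by
    intro l l' hll hl'
    by_cases h0 : l = 0 ∧ l' = m
    · rw [h0.1, h0.2]
      exact hends
    · exact hnot l l' hll hl' h0
  -- The walk is closed through `S`, which is the last neighborhood; index `m + 1` is `a` again.
  refine hN.2 (m + 1) (fun l => if (l : ℕ) ≤ m then p.getVert l else a)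
    (fun l => if (l : ℕ) < m then k l else S) ⟨by omega, ⟨?_, ?_, ?_, ?_, ?_⟩, ?_⟩
  · intro l
    split_ifs with h1
    exacts [hk _ h1, hS]
  · have key : ∀ l l' : Fin (m + 1), l < l' →
        (if (l : ℕ) < m then k l else S) ≠ (if (l' : ℕ) < m then k l' else S) := by
      intro l l' hll heq
      have hll' : (l : ℕ) < l' := hll
      have h1 : (l : ℕ) < m := by omega
      rw [if_pos h1] at heq
      split_ifs at heq with h2
      · have h3 := N.dist_le_succ_of_mem (a := a) (hk l h1) (hkS l h1) (hkl l h1)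
          (heq ▸ hkr l' h2)
        rw [← hG, hdist _ (by omega), hdist _ (by omega)] at h3
        omega
      · exact hkS l h1 heq
    intro l l' heq
    rcases lt_trichotomy l l' with h1 | h1 | h1
    exacts [absurd heq (key l l' h1), h1, absurd heq.symm (key l' l h1)]
  · intro l
    have h1 : (l : ℕ) ≤ m := by omega
    simp only [Fin.val_castSucc, h1, if_true]
    split_ifs with h2
    · exact hkl _ h2
    · rw [show (l : ℕ) = m by omega, hm, p.getVert_length]
      exact hx
  · intro l
    simp only [Fin.val_succ]
    by_cases h2 : (l : ℕ) < m
    · rw [if_pos h2, if_pos (by omega)]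
      exact hkr _ h2
    · rw [if_neg h2, if_neg (by omega)]
      exact ha
  · intro l l' hll hne
    have hll' : (l : ℕ) < l' := hll
    have h1 : (l : ℕ) ≤ m := by omega
    simp only [h1, if_true]
    split_ifs with h2
    · exact hnot' _ _ hll' h2
    · intro hsame
      have h3 : 0 < (l : ℕ) := by
        rcases Nat.eq_zero_or_pos (l : ℕ) with h0 | h0
        · refine absurd ⟨Fin.ext h0, Fin.ext ?_⟩ hne
          simp only [Fin.val_last]
          omega
        · exact h0
      refine hnot' 0 l h3 h1 ?_
      rw [p.getVert_zero]
      exact SameParticle.symm N hsame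
  · simp

open Classical in
/-- The coarse-grained subsystem of `a`. -/
noncomputable def particle (a : Fin n) : Finset (Fin n) := Finset.univ.filter fun b => N.SameParticle a b

theorem mem_particle {a b : Fin n} : b ∈ N.particle a ↔ N.SameParticle a b := by
  simp [particle]

theorem self_mem_particle (a : Fin n) : a ∈ N.particle a := N.mem_particle.2 fun _ _ => Iff.rfl

theorem particle_subset {S : Finset (Fin n)} (hS : S ∈ N.nbhds) {a : Fin n} (ha : a ∈ S) :
    N.particle a ⊆ S := fun _ hb => ((N.mem_particle.1 hb) S hS).1 ha

/-- The partition `A ∪ p ∪ C` of the system separates `S`, on the side of `A`, from the other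
neighborhoods of the coarse-grained subsystem `p`, on the side of `C`. -/
structure Separates (S A p C : Finset (Fin n)) : Prop where
  disjoint_left : Disjoint A p
  disjoint_right : Disjoint C p
  disjoint : Disjoint A C
  cover : ∀ a, a ∈ A ∨ a ∈ p ∨ a ∈ C
  mem_subset : S ⊆ A ∪ p
  other_subset : ∀ T ∈ N.nbhds, T ≠ S → ¬ Disjoint T p → p ⊆ T ∧ T ⊆ p ∪ C
  subset_or : ∀ T ∈ N.nbhds, T ⊆ A ∪ p ∨ T ⊆ p ∪ C

open Classical in
-- Let `R` be the component of `a` when `S` is not used for adjacency. A neighborhood other than `S`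
-- is contained in `R` or disjoint from it, and `S` meets `R` only inside the particle of `a`, since
-- otherwise there would be a cycle.
theorem IsTreeLike.exists_separates (hN : N.IsTreeLike) {S : Finset (Fin n)} (hS : S ∈ N.nbhds)
    {a : Fin n} (ha : a ∈ S) : ∃ A C, N.Separates S A (N.particle a) C := by
  set R : Finset (Fin n) := Finset.univ.filter fun x => (N.adjWithout S).Reachable a x with hR
  have memR : ∀ x, x ∈ R ↔ (N.adjWithout S).Reachable a x := by simp [hR]
  have hsub : S ⊆ (R ∪ N.particle a)ᶜ ∪ N.particle a := by
    intro x hx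
    by_cases h : x ∈ R
    · exact Finset.mem_union_right _ (N.mem_particle.2
        (hN.sameParticle_of_reachable N hS ha hx ((memR x).1 h)))
    · by_cases h' : x ∈ N.particle a <;> simp [h, h']
  have hmeet : ∀ T ∈ N.nbhds, T ≠ S → ∀ x ∈ T, x ∈ R → T ⊆ R := by
    intro T hT hTS x hxT hxR y hy
    exact (memR y).2 (((memR x).1 hxR).trans (N.reachable_of_mem hT hTS hxT hy))
  have hRsub : R ⊆ N.particle a ∪ R \ N.particle a := by
    intro x hx
    by_cases h : x ∈ N.particle a <;> simp [h, hx]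
  -- The particle need not lie in `R`: if `S` is the only neighborhood of `a`, then `R = {a}`. It is
  -- thus removed from both sides.
  refine ⟨(R ∪ N.particle a)ᶜ, R \ N.particle a, ?_, ?_, ?_, ?_, hsub, ?_, ?_⟩
  · exact Finset.disjoint_left.2 fun x hx hx' => by simp [hx'] at hx
  · exact Finset.sdiff_disjoint
  · exact Finset.disjoint_left.2 fun x hx hx' => by
      simp only [Finset.mem_compl, Finset.mem_union, Finset.mem_sdiff] at hx hx'
      tauto
  · intro x
    simp only [Finset.mem_compl, Finset.mem_union, Finset.mem_sdiff]
    tauto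
  · intro T hT hTS hTp
    obtain ⟨x, hxT, hxp⟩ := Finset.not_disjoint_iff.1 hTp
    have haT : a ∈ T := ((N.mem_particle.1 hxp) T hT).2 hxT
    exact ⟨N.particle_subset hT haT,
      (hmeet T hT hTS a haT ((memR a).2 (SimpleGraph.Reachable.refl _))).trans hRsub⟩
  · intro T hT
    by_cases hTS : T = S
    · exact Or.inl (hTS ▸ hsub)
    by_cases h : ∃ x ∈ T, x ∈ R
    · obtain ⟨x, h1, h2⟩ := h
      exact Or.inr ((hmeet T hT hTS x h1 h2).trans hRsub)
    · refine Or.inl fun x hx => ?_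
      have hxR : x ∉ R := fun h' => h ⟨x, hx, h'⟩
      by_cases h' : x ∈ N.particle a <;> simp [hxR, h']

end NeighborhoodStructure

/-! ### Clustering -/

/-- The expectation value `⟨ψ|X|ψ⟩`. -/
noncomputable def expect (ψ : Hilb d) : Op d →ₗ[ℂ] ℂ where
  toFun X := star ψ.ofLp ⬝ᵥ (X *ᵥ ψ.ofLp)
  map_add' X Y := by rw [Matrix.add_mulVec, dotProduct_add]
  map_smul' c X := by rw [Matrix.smul_mulVec, dotProduct_smul, RingHom.id_apply]

theorem expect_apply (ψ : Hilb d) (X : Op d) :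
    expect ψ X = star ψ.ofLp ⬝ᵥ (X *ᵥ ψ.ofLp) := rfl

theorem expect_one (ψ : Hilb d) (hψ : ‖ψ‖ = 1) : expect ψ 1 = 1 := by
  rw [expect_apply, Matrix.one_mulVec, star_dotProduct_self ψ hψ]

theorem star_mulVec_dotProduct (ψ : Hilb d) (X Y : Op d) :
    star (X *ᵥ ψ.ofLp) ⬝ᵥ (Y *ᵥ ψ.ofLp) = expect ψ (Xᴴ * Y) := by
  rw [expect_apply, Matrix.star_mulVec, ← Matrix.mulVec_mulVec, ← Matrix.dotProduct_mulVec]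

theorem trace_mul_pureState (ψ : Hilb d) (X : Op d) : (X * pureState ψ).trace = expect ψ X := by
  rw [pureState_eq, Matrix.mul_vecMulVec, Matrix.trace_vecMulVec, expect_apply, dotProduct_comm]

/-- The operators on `A` and on `C` are uncorrelated in the state `ψ`. -/
def Clusters (ψ : Hilb d) (A C : Finset (Fin n)) : Prop :=
  ∀ X ∈ localOps d A, ∀ Y ∈ localOps d C, expect ψ (X * Y) = expect ψ X * expect ψ Y

theorem conjTranspose_mem_localOps {S : Finset (Fin n)} {X : Op d} (hX : X ∈ localOps d S) :
    Xᴴ ∈ localOps d S := star_mem hX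

/-- If the part of `S` outside `p` and the part of `T` outside `p` are uncorrelated, then `Π_S`
and `Π_T` commute. -/
theorem Clusters.commute {ψ : Hilb d} {A p C S T : Finset (Fin n)} (h : Clusters ψ A C)
    (hAC : Disjoint A C) (hcover : ∀ a, a ∈ A ∨ a ∈ p ∨ a ∈ C) (hpS : p ⊆ S) (hpT : p ⊆ T)
    (hAS : Disjoint A S) (hCT : Disjoint C T) :
    Commute (nbhdProj S ψ) (nbhdProj T ψ) := by
  have hSc : Sᶜ ⊆ A ∪ (C \ S) := by
    intro x hx
    have h1 := hcover x
    have h2 := @hpS x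
    simp only [Finset.mem_compl, Finset.mem_union, Finset.mem_sdiff] at hx ⊢
    tauto
  have hTc : Tᶜ ⊆ C ∪ (A \ T) := by
    intro x hx
    have h1 := hcover x
    have h2 := @hpT x
    simp only [Finset.mem_compl, Finset.mem_union, Finset.mem_sdiff] at hx ⊢
    tauto
  have hASc : A ⊆ Sᶜ := Finset.subset_compl_iff_disjoint_right.2 hAS
  have hCTc : C ⊆ Tᶜ := Finset.subset_compl_iff_disjoint_right.2 hCT
  have hgen : ∀ Y ∈ localOps d A, ∀ X ∈ localOps d (C \ S),
      nbhdProj S ψ *ᵥ (nbhdProj T ψ *ᵥ ((Y * X) *ᵥ ψ.ofLp)) =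
        nbhdProj T ψ *ᵥ ((Y * X) *ᵥ ψ.ofLp) := by
    intro Y hY X hX
    have hXC : X ∈ localOps d C := localOps_mono Finset.sdiff_subset hX
    -- The range of `P` is the set of vectors `Y₁ψ` with `Y₁` on `A \ T`, so `Y0 ψ` is the best
    -- approximation of `Yψ` by such vectors.
    set P := nbhdProj (A \ T)ᶜ ψ with hP
    obtain ⟨Y0, hY0, hYψ⟩ := (nbhdProj_mulVec_eq_self_iff (A \ T)ᶜ ψ (P *ᵥ (Y *ᵥ ψ.ofLp))).1
      (by rw [Matrix.mulVec_mulVec, nbhdProj_mul_self])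
    rw [compl_compl] at hY0
    have hY0A : Y0 ∈ localOps d A := localOps_mono Finset.sdiff_subset hY0
    have horth : ∀ Y1 ∈ localOps d (A \ T), expect ψ (Y1ᴴ * (Y - Y0)) = 0 := by
      intro Y1 hY1
      rw [← star_mulVec_dotProduct, Matrix.sub_mulVec, dotProduct_sub, ← hYψ,
        star_dotProduct_nbhdProj, (nbhdProj_mulVec_eq_self_iff (A \ T)ᶜ ψ _).2
          ⟨Y1, by rwa [compl_compl], rfl⟩, sub_self]
    -- The range of `Π_T` is spanned by vectors `X₁Y₁ψ` with `X₁` on `C` and `Y₁` on `A \ T`.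
    -- Clustering splits the overlap with `(Y - Y0)Xψ` into two factors, and the one on `A` vanishes
    -- by `horth`.
    have hzero : nbhdProj T ψ *ᵥ (((Y - Y0) * X) *ᵥ ψ.ofLp) = 0 := by
      obtain ⟨Z, hZ, hZψ⟩ := (nbhdProj_mulVec_eq_self_iff T ψ
        (nbhdProj T ψ *ᵥ (((Y - Y0) * X) *ᵥ ψ.ofLp))).1
        (by rw [Matrix.mulVec_mulVec, nbhdProj_mul_self])
      have hspan := localOps_union (hAC.symm.mono_right Finset.sdiff_subset) (localOps_mono hTc hZ)
      have h0 : expect ψ (Zᴴ * ((Y - Y0) * X)) = 0 := by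
        clear hZψ hZ
        induction hspan using Submodule.span_induction with
        | mem Z hZ =>
          obtain ⟨X1, hX1, Y1, hY1, rfl⟩ := hZ
          have hX1' := conjTranspose_mem_localOps hX1
          have hdiff : Y - Y0 ∈ localOps d A := sub_mem hY hY0A
          have hY1' := localOps_mono Finset.sdiff_subset (conjTranspose_mem_localOps hY1)
          have e : (X1 * Y1)ᴴ * ((Y - Y0) * X) = (Y1ᴴ * (Y - Y0)) * (X1ᴴ * X) := by
            rw [Matrix.conjTranspose_mul, mul_assoc, ← mul_assoc X1ᴴ,
              localOps_commute hAC.symm hX1' hdiff]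
            simp only [mul_assoc]
          rw [e, h _ (mul_mem hY1' hdiff) _ (mul_mem hX1' hXC), horth Y1 hY1, zero_mul]
        | zero => simp
        | add Z W _ _ hZ hW => rw [Matrix.conjTranspose_add, add_mul, map_add, hZ, hW, add_zero]
        | smul c Z _ hZ => rw [Matrix.conjTranspose_smul, smul_mul_assoc, map_smul, hZ, smul_zero]
      rw [← star_mulVec_dotProduct, ← hZψ, ← star_dotProduct_nbhdProj] at h0
      have h1 := star_dotProduct_nbhdProj T ψ (((Y - Y0) * X) *ᵥ ψ.ofLp)
        (nbhdProj T ψ *ᵥ (((Y - Y0) * X) *ᵥ ψ.ofLp))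
      rw [Matrix.mulVec_mulVec, nbhdProj_mul_self, h0] at h1
      exact dotProduct_star_self_eq_zero.1 h1.symm
    have hproj : nbhdProj T ψ *ᵥ ((Y * X) *ᵥ ψ.ofLp) = (Y0 * X) *ᵥ ψ.ofLp := by
      have h1 : nbhdProj T ψ *ᵥ ((Y0 * X) *ᵥ ψ.ofLp) = (Y0 * X) *ᵥ ψ.ofLp :=
        (nbhdProj_mulVec_eq_self_iff T ψ _).2 ⟨Y0 * X, mul_mem
          (localOps_mono (fun x hx => Finset.mem_compl.2 (Finset.mem_sdiff.1 hx).2) hY0)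
          (localOps_mono hCTc hXC), rfl⟩
      rw [sub_mul, Matrix.sub_mulVec, Matrix.mulVec_sub, sub_eq_zero] at hzero
      rw [hzero, h1]
    rw [hproj]
    exact (nbhdProj_mulVec_eq_self_iff S ψ _).2 ⟨Y0 * X, mul_mem (localOps_mono hASc hY0A)
      (localOps_mono (fun x hx => Finset.mem_compl.2 (Finset.mem_sdiff.1 hx).2) hX), rfl⟩
  have hpres : nbhdProj S ψ * (nbhdProj T ψ * nbhdProj S ψ) = nbhdProj T ψ * nbhdProj S ψ := by
    refine ext_mulVec fun f x => congrFun ?_ x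
    obtain ⟨Z, hZ, hZψ⟩ := (nbhdProj_mulVec_eq_self_iff S ψ (nbhdProj S ψ *ᵥ f)).1
      (by rw [Matrix.mulVec_mulVec, nbhdProj_mul_self])
    simp only [← Matrix.mulVec_mulVec, hZψ]
    have hspan := localOps_union (hAC.mono_right Finset.sdiff_subset) (localOps_mono hSc hZ)
    clear hZψ hZ
    induction hspan using Submodule.span_induction with
    | mem Z hZ =>
      obtain ⟨Y, hY, X, hX, rfl⟩ := hZ
      exact hgen Y hY X hX
    | zero => simp
    | add Z W _ _ hZ hW => simp only [Matrix.add_mulVec, Matrix.mulVec_add, hZ, hW]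
    | smul c Z _ hZ => simp only [Matrix.smul_mulVec, Matrix.mulVec_smul, hZ]
  -- `Π_S Π_T Π_S` is self-adjoint, so `hpres` and its adjoint identify both products with it.
  have h2 := congrArg Matrix.conjTranspose hpres
  simp only [Matrix.conjTranspose_mul, nbhdProj_conjTranspose] at h2
  rw [Commute, SemiconjBy, ← h2, mul_assoc, hpres]

/-! ### Robust stabilizability implies clustering -/

/-- A product of maps applies its last factor first, so this ordering lets the maps with property
`q` act before all others. -/
theorem exists_perm_ofFn_eq_append {T : ℕ} (q : Fin T → Prop) :
    ∃ (π : Equiv.Perm (Fin T)) (l₁ l₂ : List (Fin T)), List.ofFn π = l₂ ++ l₁ ∧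
      (∀ t ∈ l₁, q t) ∧ ∀ t ∈ l₂, ¬ q t := by
  classical
  set l₁ := (List.finRange T).filter fun t => q t with hl₁
  set l₂ := (List.finRange T).filter fun t => ¬ q t with hl₂
  have hperm : (l₁ ++ l₂).Perm (List.finRange T) := by
    have := List.filter_append_perm (fun t => decide (q t)) (List.finRange T)
    simpa [hl₁, hl₂] using this
  have hperm' : (l₂ ++ l₁).Perm (List.finRange T) := List.perm_append_comm.trans hperm
  have hlen : (l₂ ++ l₁).length = T := by rw [hperm'.length_eq, List.length_finRange]
  have hnd : (l₂ ++ l₁).Nodup := hperm'.nodup_iff.2 (List.nodup_finRange T)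
  have hall : ∀ t, t ∈ l₂ ++ l₁ := fun t => hperm'.mem_iff.2 (List.mem_finRange t)
  refine ⟨(finCongr hlen.symm).trans (hnd.getEquivOfForallMemList _ hall), l₁, l₂, ?_, ?_, ?_⟩
  · refine List.ext_get (by simp [← hlen]) fun i h1 h2 => ?_
    simp [List.Nodup.getEquivOfForallMemList]
  · intro t ht
    simpa [hl₁] using ht
  · intro t ht
    simpa [hl₂] using ht

/-- The Kraus operators on `S` commute with operators acting away from `S`. -/
theorem IsNeighborhoodMap.map_mul_mul {S W : Finset (Fin n)} (hW : Disjoint W S)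
    {E : Module.End ℂ (Op d)} (hE : IsNeighborhoodMap S E) {Z : Op d} (hZ : Z ∈ localOps d W)
    (σ : Op d) : E (Z * σ * Zᴴ) = Z * E σ * Zᴴ := by
  obtain ⟨r, M, h1, -⟩ := hE
  rw [h1, h1, Finset.mul_sum, Finset.sum_mul]
  refine Finset.sum_congr rfl fun i _ => ?_
  have e1 := localOps_commute hW hZ (extend_mem_localOps S (M i))
  have e2 := localOps_commute hW (conjTranspose_mem_localOps hZ)
    (conjTranspose_mem_localOps (extend_mem_localOps S (M i)))
  simp only [← mul_assoc, e1]
  simp only [mul_assoc, e2]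

/-- No signalling: `X` commutes past the Kraus operators, and `∑ Mᴴ M = 1` removes them. -/
theorem IsNeighborhoodMap.trace_mul {S W : Finset (Fin n)} (hW : Disjoint W S)
    {E : Module.End ℂ (Op d)} (hE : IsNeighborhoodMap S E) {X : Op d} (hX : X ∈ localOps d W)
    (σ : Op d) : (X * E σ).trace = (X * σ).trace := by
  obtain ⟨r, M, h1, h2⟩ := hE
  rw [h1, Finset.mul_sum, Matrix.trace_sum]
  have : ∀ i, (X * (extend S (M i) * σ * (extend S (M i))ᴴ)).trace =
      (((extend S (M i))ᴴ * extend S (M i)) * (σ * X)).trace := by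
    intro i
    have e1 := localOps_commute hW hX (extend_mem_localOps S (M i))
    rw [← mul_assoc, ← mul_assoc, e1, Matrix.trace_mul_comm, mul_assoc _ X σ, ← mul_assoc,
      ← mul_assoc, Matrix.trace_mul_comm (_ * X) σ, Matrix.trace_mul_comm _ (σ * X),
      mul_assoc σ X, localOps_commute hW hX
        (mul_mem (conjTranspose_mem_localOps (extend_mem_localOps S (M i)))
        (extend_mem_localOps S (M i)))]
  rw [Finset.sum_congr rfl fun i _ => this i, ← Matrix.trace_sum, ← Finset.sum_mul, h2, one_mul,
    Matrix.trace_mul_comm]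

theorem isDensity_pureState (ψ : Hilb d) (hψ : ‖ψ‖ = 1) : IsDensity (pureState ψ) := by
  refine ⟨?_, ?_⟩
  · rw [pureState_eq]
    exact Matrix.posSemidef_vecMulVec_self_star _
  · have := trace_mul_pureState ψ 1
    rwa [one_mul, expect_one ψ hψ] at this

/-- In an order where the maps inside `A ∪ p` act first, the state `Zψ` with `Z` on `C` survives the
first group, and the second group preserves expectation values on `A` while producing `ψ`. This
gives clustering against `Zᴴ * Z`, and polarization extends it to all operators on `C`. -/
theorem NeighborhoodStructure.IsRFTS.clusters {N : NeighborhoodStructure n} {ψ : Hilb d}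
    (hψ : ‖ψ‖ = 1) (hR : N.IsRFTS (pureState ψ)) {S A p C : Finset (Fin n)}
    (hsep : N.Separates S A p C) : Clusters ψ A C := by
  obtain ⟨T, E, hE, hfix, hprod⟩ := hR
  choose s hs hEs using hE
  obtain ⟨π, l₁, l₂, hπ, hl₁, hl₂⟩ := exists_perm_ofFn_eq_append fun t => s t ⊆ A ∪ p
  have hl₂' : ∀ t ∈ l₂, s t ⊆ p ∪ C := fun t ht => (hsep.subset_or _ (hs t)).resolve_left (hl₂ t ht)
  have hF : ∀ Z ∈ localOps d C, (l₁.map E).prod (Z * pureState ψ * Zᴴ) = Z * pureState ψ * Zᴴ := by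
    intro Z hZ
    have hd : ∀ t ∈ l₁, Disjoint C (s t) := fun t ht =>
      (Finset.disjoint_union_right.2 ⟨hsep.disjoint.symm, hsep.disjoint_right⟩).mono_right (hl₁ t ht)
    clear hπ hl₁
    induction l₁ with
    | nil => simp
    | cons t l ih =>
      rw [List.map_cons, List.prod_cons, Module.End.mul_apply,
        ih fun t ht => hd t (List.mem_cons_of_mem _ ht),
        (hEs t).map_mul_mul (hd t List.mem_cons_self) hZ, hfix]
  have hG : ∀ X ∈ localOps d A, ∀ σ, (X * (l₂.map E).prod σ).trace = (X * σ).trace := by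
    intro X hX
    have hd : ∀ t ∈ l₂, Disjoint A (s t) := fun t ht =>
      (Finset.disjoint_union_right.2 ⟨hsep.disjoint_left, hsep.disjoint⟩).mono_right (hl₂' t ht)
    clear hπ hl₂ hl₂'
    induction l₂ with
    | nil => simp
    | cons t l ih =>
      intro σ
      rw [List.map_cons, List.prod_cons, Module.End.mul_apply,
        (hEs t).trace_mul (hd t List.mem_cons_self) hX,
        ih fun t ht => hd t (List.mem_cons_of_mem _ ht)]
  have hGF : ∀ σ, IsDensity σ → (l₂.map E).prod ((l₁.map E).prod σ) = pureState ψ := by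
    intro σ hσ
    rw [← Module.End.mul_apply, ← List.prod_append, ← List.map_append, ← hπ, List.map_ofFn]
    exact hprod π σ hσ
  have hpos : ∀ X ∈ localOps d A, ∀ Z ∈ localOps d C,
      expect ψ (X * (Zᴴ * Z)) = expect ψ X * expect ψ (Zᴴ * Z) := by
    intro X hX Z hZ
    have htr : ∀ W ∈ localOps d A, (W * (Z * pureState ψ * Zᴴ)).trace = expect ψ (W * (Zᴴ * Z)) := by
      intro W hW
      rw [← trace_mul_pureState, ← mul_assoc, Matrix.trace_mul_comm, ← mul_assoc, ← mul_assoc,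
        ← localOps_commute hsep.disjoint hW (conjTranspose_mem_localOps hZ)]
      simp only [mul_assoc]
    -- If `Zψ = 0`, both sides vanish; otherwise `Zψ` can be normalized to an admissible initial
    -- state.
    by_cases h0 : expect ψ (Zᴴ * Z) = 0
    · rw [h0, mul_zero]
      rw [← star_mulVec_dotProduct] at h0
      have h1 : Z *ᵥ ψ.ofLp = 0 := dotProduct_star_self_eq_zero.1 h0
      rw [expect_apply, ← Matrix.mulVec_mulVec, ← Matrix.mulVec_mulVec, h1]
      simp
    · set t := expect ψ (Zᴴ * Z) with ht
      have ht0 : 0 ≤ t := by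
        rw [ht, ← star_mulVec_dotProduct]
        exact dotProduct_star_self_nonneg _
      have hρ := isDensity_pureState ψ hψ
      have hden : IsDensity (t⁻¹ • (Z * pureState ψ * Zᴴ)) := by
        refine ⟨(hρ.1.mul_mul_conjTranspose_same Z).smul (inv_nonneg.2 ht0), ?_⟩
        have := htr 1 (one_mem _)
        rw [one_mul, one_mul] at this
        rw [Matrix.trace_smul, this, ← ht, smul_eq_mul, inv_mul_cancel₀ h0]
      have h1 := hGF _ hden
      rw [map_smul, map_smul, hF Z hZ] at h1
      have h2 := hG X hX (Z * pureState ψ * Zᴴ)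
      rw [htr X hX] at h2
      have h3 : (l₂.map E).prod (Z * pureState ψ * Zᴴ) = t • pureState ψ := by
        refine Eq.trans ?_ (congrArg (t • ·) h1)
        simp only [smul_smul, mul_inv_cancel₀ h0, one_smul]
      rw [h3, mul_smul_comm, Matrix.trace_smul, trace_mul_pureState, smul_eq_mul] at h2
      rw [← h2, mul_comm]
  intro X hX Y hY
  have hYs := conjTranspose_mem_localOps hY
  -- With `D(Y) = ⟨XY⟩ - ⟨X⟩⟨Y⟩`, the choice `1 + Y` yields `D(Y) + D(Yᴴ) = 0` and `1 + iY` yields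
  -- `D(Y) - D(Yᴴ) = 0`.
  have h1 := hpos X hX (1 + Y) (add_mem (one_mem _) hY)
  have h2 := hpos X hX (1 + Complex.I • Y) (add_mem (one_mem _) (Subalgebra.smul_mem _ hY _))
  have h3 := hpos X hX Y hY
  have h4 := expect_one ψ hψ
  simp only [Matrix.conjTranspose_add, Matrix.conjTranspose_one, Matrix.conjTranspose_smul, mul_add,
    add_mul, one_mul, mul_one, smul_mul_assoc, mul_smul_comm, map_add, map_smul, smul_eq_mul,
    h3, h4, RCLike.star_def, Complex.conj_I] at h1 h2
  have hI := Complex.I_mul_I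
  linear_combination (1 / 2 : ℂ) * h1 - (Complex.I / 2) * h2 +
    (1 / 2 : ℂ) * (expect ψ (X * Y) - expect ψ X * expect ψ Y - expect ψ (X * Yᴴ) +
      expect ψ X * expect ψ Yᴴ) * hI

/-! ### The Hamiltonian of a robustly stabilizable state -/

/-- The Kraus operators of a channel with a pure invariant state have this state as an
eigenvector. -/
theorem exists_mulVec_eq_smul_of_sum_eq {r : ℕ} (M : Fin r → Op d) (ψ : Hilb d) (hψ : ‖ψ‖ = 1)
    (h : ∑ i, M i * pureState ψ * (M i)ᴴ = pureState ψ) (i : Fin r) :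
    M i *ᵥ ψ.ofLp = expect ψ (M i) • ψ.ofLp := by
  have h1 := star_dotProduct_self ψ hψ
  set w := M i *ᵥ ψ.ofLp - expect ψ (M i) • ψ.ofLp with hw
  have hwψ : star w ⬝ᵥ ψ.ofLp = 0 := by
    have h2 : star ψ.ofLp ⬝ᵥ w = 0 := by
      rw [hw, dotProduct_sub, dotProduct_smul, h1, ← expect_apply, smul_eq_mul, mul_one, sub_self]
    have h3 := congrArg star h2
    rwa [Matrix.star_dotProduct, star_star, star_zero] at h3
  -- `w` is the component of `M i ψ` orthogonal to `ψ`. Its expectation in the invariant state is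
  -- `0`, yet it equals `∑ |⟨w|M j ψ⟩|²`; the term `j = i` forces `‖w‖ = 0`.
  have h2 : star w ⬝ᵥ ((∑ i, M i * pureState ψ * (M i)ᴴ) *ᵥ w) = 0 := by
    rw [h, pureState_eq, Matrix.vecMulVec_mulVec, dotProduct_smul, hwψ, smul_zero]
  have h3 : ∀ j, star w ⬝ᵥ ((M j * pureState ψ * (M j)ᴴ) *ᵥ w) =
      (star w ⬝ᵥ (M j *ᵥ ψ.ofLp)) * star (star w ⬝ᵥ (M j *ᵥ ψ.ofLp)) := by
    intro j
    rw [← Matrix.mulVec_mulVec, ← Matrix.mulVec_mulVec, pureState_eq, Matrix.vecMulVec_mulVec,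
      Matrix.mulVec_smul, dotProduct_smul, Matrix.star_dotProduct,
      Matrix.star_mulVec, Matrix.conjTranspose_conjTranspose, ← Matrix.dotProduct_mulVec]
    simp
  rw [Matrix.sum_mulVec, dotProduct_sum, Finset.sum_congr rfl fun j _ => h3 j,
    Finset.sum_eq_zero_iff_of_nonneg fun j _ => mul_star_self_nonneg _] at h2
  have h4 : star w ⬝ᵥ (M i *ᵥ ψ.ofLp) = 0 := by
    have := h2 i (Finset.mem_univ _)
    rcases mul_eq_zero.1 this with h | h
    exacts [h, star_eq_zero.1 h]
  have h5 : star w ⬝ᵥ w = 0 := by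
    conv_lhs => rw [hw]
    rw [← hw, dotProduct_sub, dotProduct_smul, h4, hwψ, smul_zero, sub_zero]
  exact sub_eq_zero.1 (dotProduct_star_self_eq_zero.1 h5)

theorem mul_vecMulVec_mul_conjTranspose (M : Op d) (f g : Config d → ℂ) :
    M * Matrix.vecMulVec f (star g) * Mᴴ = Matrix.vecMulVec (M *ᵥ f) (star (M *ᵥ g)) := by
  rw [Matrix.mul_vecMulVec, Matrix.vecMulVec_mul, Matrix.star_mulVec]

/-- A neighborhood map that leaves `ψ` invariant leaves all pure states in the range of `Π_S`
invariant. -/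
theorem IsNeighborhoodMap.map_pureState {S : Finset (Fin n)} {E : Module.End ℂ (Op d)}
    (hE : IsNeighborhoodMap S E) {ψ : Hilb d} (hψ : ‖ψ‖ = 1) (hfix : E (pureState ψ) = pureState ψ)
    {φ : Hilb d} (hφ : nbhdProj S ψ *ᵥ φ.ofLp = φ.ofLp) : E (pureState φ) = pureState φ := by
  obtain ⟨r, M, h1, h2⟩ := hE
  set c : Fin r → ℂ := fun i => expect ψ (extend S (M i)) with hc
  have hMψ : ∀ i, extend S (M i) *ᵥ ψ.ofLp = c i • ψ.ofLp :=
    exists_mulVec_eq_smul_of_sum_eq (fun i => extend S (M i)) ψ hψ ((h1 _).symm.trans hfix)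
  -- `φ = Zψ` with `Z` outside `S`, so the eigenvalue of `ψ` carries over to `φ`.
  have hMφ : ∀ i, extend S (M i) *ᵥ φ.ofLp = c i • φ.ofLp := by
    intro i
    obtain ⟨Z, hZ, hφZ⟩ := (nbhdProj_mulVec_eq_self_iff S ψ _).1 hφ
    rw [hφZ, localOps_mulVec_comm disjoint_compl_right (extend_mem_localOps S (M i)) hZ, hMψ,
      Matrix.mulVec_smul]
  have hsum : ∑ i, c i * star (c i) = 1 := by
    have h3 := expect_one ψ hψ
    rw [← h2, map_sum] at h3
    rw [← h3]
    refine Finset.sum_congr rfl fun i _ => ?_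
    rw [← star_mulVec_dotProduct, hMψ, star_smul, smul_dotProduct, dotProduct_smul,
      star_dotProduct_self ψ hψ]
    simp [mul_comm]
  rw [h1]
  have : ∀ i, extend S (M i) * pureState φ * (extend S (M i))ᴴ =
      (c i * star (c i)) • pureState φ := by
    intro i
    rw [pureState_eq, mul_vecMulVec_mul_conjTranspose, hMφ, star_smul, Matrix.smul_vecMulVec,
      Matrix.vecMulVec_smul, smul_smul]
  rw [Finset.sum_congr rfl fun i _ => this i, ← Finset.sum_smul, hsum, one_smul]

/-- A ground state is in the range of every `Π_S`, so all the maps fix it; but their composition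
sends it to `ψ`. -/
theorem NeighborhoodStructure.IsRFTS.isUniqueGroundState {N : NeighborhoodStructure n} {ψ : Hilb d}
    (hψ : ‖ψ‖ = 1) (hR : N.IsRFTS (pureState ψ)) :
    IsUniqueGroundState (N.canonicalHamiltonian ψ) ψ := by
  have hiff := isGroundState_canonicalHamiltonian_iff N ψ hψ
  refine ⟨(hiff ψ).2 ⟨hψ, fun S _ => nbhdProj_mulVec_self S ψ⟩, fun φ hφ => ?_⟩
  obtain ⟨hφ1, hφ⟩ := (hiff φ).1 hφ
  obtain ⟨T, E, hE, hfix, hprod⟩ := hR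
  have h1 := hprod 1 (pureState φ) (isDensity_pureState φ hφ1)
  have h2 : ∀ l : List (Fin T), (l.map E).prod (pureState φ) = pureState φ := by
    intro l
    induction l with
    | nil => simp
    | cons t l ih =>
      obtain ⟨S, hS, hES⟩ := hE t
      rw [List.map_cons, List.prod_cons, Module.End.mul_apply, ih,
        hES.map_pureState hψ (hfix t) (hφ S hS)]
  have h3 : pureState φ = pureState ψ := by
    have h3 := h2 (List.ofFn id)
    rw [List.map_ofFn] at h3
    exact h3.symm.trans h1
  have h4 : pureState φ *ᵥ φ.ofLp = φ.ofLp := by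
    rw [pureState_eq, Matrix.vecMulVec_mulVec, star_dotProduct_self φ hφ1]
    simp
  rw [h3, pureState_eq, Matrix.vecMulVec_mulVec] at h4
  refine ⟨star ψ.ofLp ⬝ᵥ φ.ofLp, ?_⟩
  ext x
  have := congrFun h4 x
  rw [← this]
  simp [mul_comm]

/-- Two distinct overlapping neighborhoods are separated at a shared coarse-grained subsystem, with
`T` on the side of `A` and `S` on the side of `C`; clustering across it gives commutation. -/
theorem NeighborhoodStructure.IsRFTS.hasCommutingHamiltonian {N : NeighborhoodStructure n}
    (hN : N.IsTreeLike) {ψ : Hilb d} (hψ : ‖ψ‖ = 1) (hR : N.IsRFTS (pureState ψ)) :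
    N.HasCommutingHamiltonian ψ := by
  intro S hS T hT
  by_cases hST : S = T
  · rw [hST]
  by_cases hdis : Disjoint S T
  · exact localOps_commute hdis (nbhdProj_mem S ψ) (nbhdProj_mem T ψ)
  obtain ⟨a, haS, haT⟩ := Finset.not_disjoint_iff.1 hdis
  obtain ⟨A, C, hsep⟩ := hN.exists_separates N hT haT
  obtain ⟨hpS, hSC⟩ := hsep.other_subset S hS hST
    (Finset.not_disjoint_iff.2 ⟨a, haS, N.self_mem_particle a⟩)
  refine (hR.clusters hψ hsep).commute hsep.disjoint hsep.cover hpS (N.particle_subset hT haT)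
    ?_ ?_
  · exact (Finset.disjoint_union_right.2 ⟨hsep.disjoint_left, hsep.disjoint⟩).mono_right hSC
  · exact (Finset.disjoint_union_right.2 ⟨hsep.disjoint.symm, hsep.disjoint_right⟩).mono_right
      hsep.mem_subset

/-! ### Clustering in the unique ground state of a commuting Hamiltonian -/

/-- Applying commuting projections one after the other gives a vector in the intersection of their
ranges. -/
theorem exists_fixed_of_commute {N : NeighborhoodStructure n} {ψ : Hilb d}
    (hc : N.HasCommutingHamiltonian ψ) (w : Config d → ℂ) (F : Finset (Finset (Fin n)))
    (hF : F ⊆ N.nbhds) :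
    ∃ w' : Config d → ℂ, (∀ T ∈ F, nbhdProj T ψ *ᵥ w' = w') ∧
      (∀ T ∈ N.nbhds, nbhdProj T ψ *ᵥ w = w → nbhdProj T ψ *ᵥ w' = w') ∧
      ∀ v : Config d → ℂ, (∀ T ∈ F, nbhdProj T ψ *ᵥ v = v) → star v ⬝ᵥ w' = star v ⬝ᵥ w := by
  induction F using Finset.induction_on with
  | empty => exact ⟨w, by simp, fun _ _ h => h, fun _ _ => rfl⟩
  | insert S F hSF ih =>
    obtain ⟨w', h1, h2, h3⟩ := ih ((Finset.subset_insert S F).trans hF)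
    have hS : S ∈ N.nbhds := hF (Finset.mem_insert_self S F)
    have hcomm : ∀ T ∈ N.nbhds, nbhdProj T ψ *ᵥ w' = w' →
        nbhdProj T ψ *ᵥ (nbhdProj S ψ *ᵥ w') = nbhdProj S ψ *ᵥ w' := by
      intro T hT h
      rw [Matrix.mulVec_mulVec, (hc T hT S hS).eq, ← Matrix.mulVec_mulVec, h]
    refine ⟨nbhdProj S ψ *ᵥ w', fun T hT => ?_, fun T hT h => hcomm T hT (h2 T hT h),
      fun v hv => ?_⟩
    · rcases Finset.mem_insert.1 hT with rfl | hT'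
      · rw [Matrix.mulVec_mulVec, nbhdProj_mul_self]
      · exact hcomm T (hF hT) (h1 T hT')
    · rw [star_dotProduct_nbhdProj, hv S (Finset.mem_insert_self S F)]
      exact h3 v fun T hT => hv T (Finset.mem_insert_of_mem hT)

open Classical in
-- Projecting `Yψ` with the `Π_T` of all `T` meeting `C` gives a common fixed vector, hence `⟨Y⟩ψ`:
-- the other projections fix `Yψ` already and commute with those applied. The `Π_T` applied belong
-- to neighborhoods disjoint from `A`, so they fix `Xᴴψ` and do not change its overlap with `Yψ`.
theorem clusters_of_commute {N : NeighborhoodStructure n} {ψ : Hilb d} (hψ : ‖ψ‖ = 1)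
    (hu : IsUniqueGroundState (N.canonicalHamiltonian ψ) ψ) (hc : N.HasCommutingHamiltonian ψ)
    {A C : Finset (Fin n)} (hAC : ∀ T ∈ N.nbhds, Disjoint A T ∨ Disjoint C T) :
    Clusters ψ A C := by
  intro X hX Y hY
  have hfix : ∀ {W : Finset (Fin n)} {Z : Op d}, Z ∈ localOps d W → ∀ T, Disjoint W T →
      nbhdProj T ψ *ᵥ (Z *ᵥ ψ.ofLp) = Z *ᵥ ψ.ofLp := fun hZ T hT =>
    (nbhdProj_mulVec_eq_self_iff T ψ _).2
      ⟨_, localOps_mono (Finset.subset_compl_iff_disjoint_right.2 hT) hZ, rfl⟩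
  obtain ⟨w, h1, h2, h3⟩ := exists_fixed_of_commute hc (Y *ᵥ ψ.ofLp)
    (N.nbhds.filter fun T => ¬ Disjoint C T) (Finset.filter_subset _ _)
  obtain ⟨c, hcw⟩ := (isUniqueGroundState_iff N ψ hψ).1 hu w fun T hT => by
    by_cases h : Disjoint C T
    · exact h2 T hT (hfix hY T h)
    · exact h1 T (Finset.mem_filter.2 ⟨hT, h⟩)
  have hψ1 := h3 ψ.ofLp fun T _ => nbhdProj_mulVec_self T ψ
  have hX1 := h3 (Xᴴ *ᵥ ψ.ofLp) fun T hT =>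
    hfix (conjTranspose_mem_localOps hX) T
      ((hAC T (Finset.mem_filter.1 hT).1).resolve_right (Finset.mem_filter.1 hT).2)
  rw [hcw, dotProduct_smul, star_dotProduct_self ψ hψ, smul_eq_mul, mul_one] at hψ1
  rw [star_mulVec_dotProduct, Matrix.conjTranspose_conjTranspose, hcw, Matrix.star_mulVec,
    Matrix.conjTranspose_conjTranspose, ← Matrix.dotProduct_mulVec, Matrix.mulVec_smul,
    dotProduct_smul, hψ1, smul_eq_mul, ← expect_apply, ← expect_apply, mul_comm] at hX1
  exact hX1.symm

/-! ### Virtual subsystems -/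

/-- `A`, `p` and `C` form a partition of the system. -/
structure Tripartition (A p C : Finset (Fin n)) : Prop where
  disjoint_left : Disjoint A p
  disjoint_right : Disjoint C p
  disjoint : Disjoint A C
  cover : ∀ a, a ∈ A ∨ a ∈ p ∨ a ∈ C

/-- The configuration of the whole system composed of configurations of the three parts. -/
def Tripartition.glue {A p C : Finset (Fin n)} (h : Tripartition A p C)
    (a : InConfig d A) (x : InConfig d p) (c : InConfig d C) : Config d := fun s =>
  if hA : s ∈ A then a ⟨s, hA⟩ else if hp : s ∈ p then x ⟨s, hp⟩ else
    c ⟨s, ((h.cover s).resolve_left hA).resolve_left hp⟩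

namespace Tripartition

variable {A p C : Finset (Fin n)} (h : Tripartition A p C)

theorem restr_left_glue (a : InConfig d A) (x : InConfig d p) (c : InConfig d C) :
    restr A (h.glue a x c) = a := by
  funext s
  simp [restr, glue]

theorem restr_middle_glue (a : InConfig d A) (x : InConfig d p) (c : InConfig d C) :
    restr p (h.glue a x c) = x := by
  funext s
  simp [restr, glue, Finset.disjoint_right.1 h.disjoint_left s.2]

theorem restr_right_glue (a : InConfig d A) (x : InConfig d p) (c : InConfig d C) :
    restr C (h.glue a x c) = c := by
  funext s
  simp [restr, glue, Finset.disjoint_right.1 h.disjoint s.2,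
    Finset.disjoint_left.1 h.disjoint_right s.2]

theorem glue_restr (z : Config d) : h.glue (restr A z) (restr p z) (restr C z) = z := by
  funext s
  simp only [glue, restr]
  split_ifs <;> rfl

theorem override_left_glue (a a' : InConfig d A) (x : InConfig d p) (c : InConfig d C) :
    override A (h.glue a x c) a' = h.glue a' x c := by
  funext s
  by_cases hA : s ∈ A <;> simp [override, glue, hA]

theorem override_middle_glue (a : InConfig d A) (x x' : InConfig d p) (c : InConfig d C) :
    override p (h.glue a x c) x' = h.glue a x' c := by
  funext s
  by_cases hp : s ∈ p
  · simp [override, glue, hp, Finset.disjoint_right.1 h.disjoint_left hp]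
  · simp [override, glue, hp]

theorem override_right_glue (a : InConfig d A) (x : InConfig d p) (c c' : InConfig d C) :
    override C (h.glue a x c) c' = h.glue a x c' := by
  funext s
  by_cases hC : s ∈ C
  · simp [override, glue, hC, Finset.disjoint_right.1 h.disjoint hC,
      Finset.disjoint_left.1 h.disjoint_right hC]
  · have := h.cover s
    by_cases hA : s ∈ A
    · simp [override, glue, hC, hA]
    · simp [override, glue, hC, hA, show s ∈ p by tauto]

/-- The bijection between configurations and triples of configurations of the three parts. -/
def equiv (d : Fin n → ℕ) : Config d ≃ InConfig d A × InConfig d p × InConfig d C where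
  toFun z := (restr A z, restr p z, restr C z)
  invFun t := h.glue t.1 t.2.1 t.2.2
  left_inv z := h.glue_restr z
  right_inv t := by
    simp only [h.restr_left_glue, h.restr_middle_glue, h.restr_right_glue]

theorem sum_eq (g : Config d → ℂ) : ∑ z, g z = ∑ a, ∑ x, ∑ c, g (h.glue a x c) := by
  rw [← (h.equiv d).symm.sum_comp, Fintype.sum_prod_type]
  simp only [Fintype.sum_prod_type]
  rfl

end Tripartition

/-- The operators `|b i j⟩⟨b i' j'|` on the subsystems in `p`. -/
def matUnit {p : Finset (Fin n)} {I J : Type} (b : I → J → InConfig d p → ℂ) (i : I) (j : J)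
    (i' : I) (j' : J) : Op d :=
  extend p (Matrix.vecMulVec (b i j) (star (b i' j')))

/-- The vectors `b i j` on `p` are orthonormal and span the support of `f`; acting on the first
index can be mirrored on `A`, and acting on the second one on `C`. -/
structure IsVirtualBasis {p : Finset (Fin n)} {I J : Type} [Fintype I] [Fintype J] [DecidableEq I]
    [DecidableEq J] (A C : Finset (Fin n)) (f : Config d → ℂ) (b : I → J → InConfig d p → ℂ) :
    Prop where
  orthonormal : ∀ i j i' j', star (b i j) ⬝ᵥ b i' j' = if i = i' ∧ j = j' then 1 else 0
  sum_mulVec : (∑ i, ∑ j, matUnit b i j i j) *ᵥ f = f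
  mirror_left : ∀ i i', ∃ Y ∈ localOps d A, (∑ j, matUnit b i j i' j) *ᵥ f = Y *ᵥ f
  mirror_right : ∀ j j', ∃ Y ∈ localOps d C, (∑ i, matUnit b i j i j') *ᵥ f = Y *ᵥ f

theorem sum_subtype_ite {γ : Type*} [Fintype γ] [DecidableEq γ] (q : γ → Prop) [DecidablePred q]
    (c : γ) (F : γ → ℂ) :
    (∑ j : {c // q c}, if c = j then F j else 0) = if q c then F c else 0 := by
  split_ifs with hc
  · rw [Finset.sum_eq_single (⟨c, hc⟩ : {c // q c})]
    · simp
    · intro j _ hj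
      rw [if_neg]
      rintro rfl
      exact hj rfl
    · simp
  · refine Finset.sum_eq_zero fun j _ => ?_
    rw [if_neg]
    rintro rfl
    exact hc j.2

/-- The hypothesis says that the slices of `f` on `p` are orthogonal with norms `|P a * Q c|`.
Normalizing the nonzero slices gives `f = ∑ P i * Q j |i⟩|b i j⟩|j⟩`, where each index of `b` is
copied in one outer part. -/
theorem exists_isVirtualBasis_of_diagonal {A p C : Finset (Fin n)} (h : Tripartition A p C)
    (f : Config d → ℂ) (P : InConfig d A → ℝ) (Q : InConfig d C → ℝ)
    (hf : ∀ a a' c c', ∑ x, star (f (h.glue a x c)) * f (h.glue a' x c') =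
      if a = a' ∧ c = c' then ((P a : ℂ) * Q c) ^ 2 else 0) :
    ∃ (I J : Type) (_ : Fintype I) (_ : Fintype J) (_ : DecidableEq I) (_ : DecidableEq J)
      (b : I → J → InConfig d p → ℂ), IsVirtualBasis A C f b := by
  classical
  have hzero : ∀ a c, P a = 0 ∨ Q c = 0 → ∀ x, f (h.glue a x c) = 0 := by
    intro a c hac x
    have h1 := hf a a c c
    have h2 : ((P a : ℂ) * Q c) ^ 2 = 0 := by
      rcases hac with h | h <;> simp [h]
    rw [if_pos ⟨rfl, rfl⟩, h2] at h1
    have h3 : star (fun x => f (h.glue a x c)) ⬝ᵥ (fun x => f (h.glue a x c)) = 0 := h1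
    exact congrFun (dotProduct_star_self_eq_zero.1 h3) x
  let b : {a // P a ≠ 0} → {c // Q c ≠ 0} → InConfig d p → ℂ := fun i j x =>
    f (h.glue i x j) / ((P i : ℂ) * Q j)
  have hP : ∀ i : {a // P a ≠ 0}, (P i : ℂ) ≠ 0 := fun i => by exact_mod_cast i.2
  have hQ : ∀ j : {c // Q c ≠ 0}, (Q j : ℂ) ≠ 0 := fun j => by exact_mod_cast j.2
  have hstarb : ∀ i j x, star (b i j x) = star (f (h.glue i x j)) / ((P i : ℂ) * Q j) := by
    intro i j x
    simp [b]
  have hbf : ∀ (i : {a // P a ≠ 0}) (j : {c // Q c ≠ 0}) a c,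
      ∑ x, star (b i j x) * f (h.glue a x c) =
        if (i : InConfig d A) = a ∧ (j : InConfig d C) = c then (P i : ℂ) * Q j else 0 := by
    intro i j a c
    simp only [hstarb, div_mul_eq_mul_div, ← Finset.sum_div, hf]
    split_ifs
    · field_simp [hP i, hQ j]
    · simp
  have hunit : ∀ i j i' j' a x c, (matUnit b i j i' j' *ᵥ f) (h.glue a x c) =
      if a = i' then if c = j' then b i j x * ((P i' : ℂ) * Q j') else 0 else 0 := by
    intro i j i' j' a x c
    rw [matUnit, extend_mulVec]
    simp only [h.restr_middle_glue, h.override_middle_glue, Matrix.vecMulVec_apply, mul_assoc,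
      Pi.star_apply]
    rw [← Finset.mul_sum, hbf, ← ite_and, mul_ite, mul_zero]
    simp only [eq_comm]
  have hmul : ∀ i j x, b i j x * ((P i : ℂ) * Q j) = f (h.glue i x j) := fun i j x =>
    div_mul_cancel₀ _ (mul_ne_zero (hP i) (hQ j))
  refine ⟨{a // P a ≠ 0}, {c // Q c ≠ 0}, inferInstance, inferInstance, inferInstance,
    inferInstance, b, ⟨?_, ?_, ?_, ?_⟩⟩
  · intro i j i' j'
    have : star (b i j) ⬝ᵥ b i' j' =
        (∑ x, star (b i j x) * f (h.glue i' x j')) / ((P i' : ℂ) * Q j') := by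
      rw [Finset.sum_div]
      refine Finset.sum_congr rfl fun x _ => ?_
      rw [mul_div_assoc]
      rfl
    rw [this, hbf]
    simp only [← Subtype.ext_iff]
    split_ifs with h1
    · rw [h1.1, h1.2]
      exact div_self (mul_ne_zero (hP i') (hQ j'))
    · simp
  · funext z
    rw [← h.glue_restr z]
    generalize restr A z = a, restr p z = x, restr C z = c
    simp only [Matrix.sum_mulVec, Finset.sum_apply, hunit, hmul]
    rw [Finset.sum_comm]
    rw [Finset.sum_congr rfl fun (j : {c // Q c ≠ 0}) _ => sum_subtype_ite (fun a => P a ≠ 0) a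
      fun a' => if c = j.1 then f (h.glue a' x j.1) else 0]
    by_cases hPa : P a ≠ 0
    · simp only [hPa, not_false_eq_true, if_true, ne_eq]
      rw [sum_subtype_ite (fun c => Q c ≠ 0) c fun c' => f (h.glue a x c')]
      split_ifs with hQc
      · rfl
      · exact (hzero a c (Or.inr (not_not.1 hQc)) x).symm
    · simp only [hPa, if_false, Finset.sum_const_zero]
      exact (hzero a c (Or.inl (not_not.1 hPa)) x).symm
  · intro i i'
    -- Replacing `b i' j` by `b i j` leaves the weight `P i'` and the label `i'` on `A`; relabelling
    -- the `i`-term of `f` to `i'` reproduces this after correcting the weight by `P i' / P i`.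
    refine ⟨extend A (Matrix.single i'.1 i.1 ((P i' : ℂ) / P i)), extend_mem_localOps _ _, ?_⟩
    funext z
    rw [← h.glue_restr z]
    generalize restr A z = a, restr p z = x, restr C z = c
    rw [extend_mulVec]
    simp only [Matrix.sum_mulVec, Finset.sum_apply, hunit, h.restr_left_glue, h.override_left_glue]
    by_cases ha : a = i'
    · subst ha
      simp only [if_true]
      rw [sum_subtype_ite (fun c => Q c ≠ 0) c
        fun c' => f (h.glue i x c') / ((P i : ℂ) * Q c') * ((P i' : ℂ) * Q c')]
      rw [Finset.sum_eq_single i.1]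
      · rw [Matrix.single_apply_same]
        split_ifs with hQc
        · have : (Q c : ℂ) ≠ 0 := by exact_mod_cast hQc
          field_simp [hP i]
        · rw [hzero _ c (Or.inr (not_not.1 hQc)), mul_zero]
      · intro u _ hu
        simp [hu.symm]
      · simp
    · simp [ha, Ne.symm ha]
  · intro j j'
    refine ⟨extend C (Matrix.single j'.1 j.1 ((Q j' : ℂ) / Q j)), extend_mem_localOps _ _, ?_⟩
    funext z
    rw [← h.glue_restr z]
    generalize restr A z = a, restr p z = x, restr C z = c
    rw [extend_mulVec]
    simp only [Matrix.sum_mulVec, Finset.sum_apply, hunit, h.restr_right_glue,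
      h.override_right_glue]
    rw [sum_subtype_ite (fun a => P a ≠ 0) a fun a' =>
      if c = j' then f (h.glue a' x j) / ((P a' : ℂ) * Q j) * ((P a' : ℂ) * Q j') else 0]
    by_cases hc : c = j'
    · subst hc
      simp only [if_true]
      rw [Finset.sum_eq_single j.1]
      · rw [Matrix.single_apply_same]
        split_ifs with hPa
        · have : (P a : ℂ) ≠ 0 := by exact_mod_cast hPa
          field_simp [hQ j]
        · rw [hzero a _ (Or.inl (not_not.1 hPa)), mul_zero]
      · intro u _ hu
        simp [hu.symm]
      · simp
    · simp [hc, Ne.symm hc]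

theorem expect_conjTranspose (ψ : Hilb d) (X : Op d) : expect ψ Xᴴ = star (expect ψ X) := by
  have h := star_mulVec_dotProduct ψ X 1
  rw [mul_one, Matrix.one_mulVec] at h
  rw [← h, expect_apply, Matrix.star_dotProduct]

/-- The matrix on the right is the reduced state on `A`; the swapped indices come from the trace
pairing. -/
theorem expect_extend_eq_trace (ψ : Hilb d) (A : Finset (Fin n))
    (X : Matrix (InConfig d A) (InConfig d A) ℂ) :
    expect ψ (extend A X) =
      (X * Matrix.of fun u v => expect ψ (extend A (Matrix.single v u 1))).trace := by
  rw [extend_eq_sum_single, map_sum, Matrix.trace]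
  refine Finset.sum_congr rfl fun u _ => ?_
  rw [map_sum, Matrix.diag_apply, Matrix.mul_apply]
  refine Finset.sum_congr rfl fun v _ => ?_
  rw [map_smul, smul_eq_mul, Matrix.of_apply]

/-- The reduced state on `A` is diagonal in some orthonormal basis. -/
theorem exists_unitary_diagonalizing (ψ : Hilb d) (A : Finset (Fin n)) :
    ∃ U : Matrix (InConfig d A) (InConfig d A) ℂ, Uᴴ * U = 1 ∧
      ∃ P : InConfig d A → ℝ, ∀ a a',
        expect ψ (extend A (Uᴴ * Matrix.single a a' 1 * U)) = if a = a' then (P a : ℂ) ^ 2 else 0 := by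
  set r : Matrix (InConfig d A) (InConfig d A) ℂ :=
    Matrix.of fun u v => expect ψ (extend A (Matrix.single v u 1)) with hr
  have hherm : r.IsHermitian := by
    ext u v
    rw [Matrix.conjTranspose_apply, hr, Matrix.of_apply, Matrix.of_apply, ← expect_conjTranspose,
      extend_conjTranspose, Matrix.conjTranspose_single, star_one]
  have hdiag := hherm.conjStarAlgAut_star_eigenvectorUnitary
  set W : Matrix (InConfig d A) (InConfig d A) ℂ :=
    hherm.eigenvectorUnitary.1 with hW
  have hWW' : W * Wᴴ = 1 := Unitary.coe_mul_star_self hherm.eigenvectorUnitary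
  rw [Unitary.conjStarAlgAut_star_apply, Matrix.star_eq_conjTranspose] at hdiag
  have key : ∀ a a', expect ψ (extend A (W * Matrix.single a a' 1 * Wᴴ)) =
      if a = a' then (hherm.eigenvalues a : ℂ) else 0 := by
    intro a a'
    rw [expect_extend_eq_trace, ← hr, mul_assoc, mul_assoc, Matrix.trace_mul_comm, mul_assoc,
      hdiag, Matrix.trace_single_mul]
    simp only [Matrix.diagonal_apply, eq_comm (a := a')]
    split_ifs with h
    · simp [h]
    · simp
  -- `Wᴴ` takes the eigenbasis to the product basis; the square roots turn probabilities into
  -- amplitudes.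
  refine ⟨Wᴴ, by rwa [Matrix.conjTranspose_conjTranspose], fun a => Real.sqrt (hherm.eigenvalues a),
    fun a a' => ?_⟩
  rw [Matrix.conjTranspose_conjTranspose, key]
  split_ifs with h
  · have hnn : (0 : ℂ) ≤ hherm.eigenvalues a := by
      have h1 := key a a
      rw [if_pos rfl] at h1
      have h2 : W * Matrix.single a a 1 * Wᴴ =
          (Matrix.single a a (1 : ℂ) * Wᴴ)ᴴ * (Matrix.single a a 1 * Wᴴ) := by
        rw [Matrix.conjTranspose_mul, Matrix.conjTranspose_conjTranspose,
          Matrix.conjTranspose_single, star_one, mul_assoc, mul_assoc,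
          ← mul_assoc (Matrix.single a a (1 : ℂ)) _ Wᴴ, Matrix.single_mul_single_same, one_mul]
      rw [← h1, h2, ← extend_mul, ← extend_conjTranspose, ← star_mulVec_dotProduct]
      exact dotProduct_star_self_nonneg _
    rw [← Complex.ofReal_pow, Real.sq_sqrt (by exact_mod_cast hnn)]
  · rfl

theorem expect_conj (ψ : Hilb d) (X W : Op d) :
    expect (WithLp.toLp 2 (W *ᵥ ψ.ofLp)) X = expect ψ (Wᴴ * X * W) := by
  rw [mul_assoc, ← star_mulVec_dotProduct, expect_apply, Matrix.mulVec_mulVec]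

theorem Tripartition.star_dotProduct_single_mulVec {A p C : Finset (Fin n)}
    (h : Tripartition A p C) (f : Config d → ℂ) (a a' : InConfig d A) (c c' : InConfig d C) :
    star f ⬝ᵥ ((extend A (Matrix.single a a' 1) * extend C (Matrix.single c c' 1)) *ᵥ f) =
      ∑ x, star (f (h.glue a x c)) * f (h.glue a' x c') := by
  rw [dotProduct, h.sum_eq]
  simp only [← Matrix.mulVec_mulVec, extend_single_mulVec, h.restr_left_glue, h.override_left_glue,
    h.restr_right_glue, h.override_right_glue, Pi.star_apply]
  rw [Finset.sum_eq_single a]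
  · refine Finset.sum_congr rfl fun x _ => ?_
    rw [Finset.sum_eq_single c]
    · simp
    · intro u _ hu
      simp [hu]
    · simp
  · intro u _ hu
    simp [hu]
  · simp

theorem matUnit_mem {p : Finset (Fin n)} {I J : Type} (b : I → J → InConfig d p → ℂ) (i : I) (j : J)
    (i' : I) (j' : J) : matUnit b i j i' j' ∈ localOps d p := extend_mem_localOps _ _

/-- A pure state in which `A` and `C` are uncorrelated has a virtual basis on the remaining part. -/
theorem exists_isVirtualBasis {A p C : Finset (Fin n)} (h : Tripartition A p C) {ψ : Hilb d}
    (hcl : Clusters ψ A C) :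
    ∃ (I J : Type) (_ : Fintype I) (_ : Fintype J) (_ : DecidableEq I) (_ : DecidableEq J)
      (b : I → J → InConfig d p → ℂ), IsVirtualBasis A C ψ.ofLp b := by
  obtain ⟨U, hU1, P, hP⟩ := exists_unitary_diagonalizing ψ A
  obtain ⟨V, hV1, Q, hQ⟩ := exists_unitary_diagonalizing ψ C
  set u : Op d := extend A U with hu
  set v : Op d := extend C V with hv
  have huA : u ∈ localOps d A := extend_mem_localOps _ _
  have hvC : v ∈ localOps d C := extend_mem_localOps _ _
  have huA' := conjTranspose_mem_localOps huA
  have hvC' := conjTranspose_mem_localOps hvC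
  have hu1 : uᴴ * u = 1 := by rw [hu, extend_conjTranspose, extend_mul, hU1, extend_one]
  have hv1 : vᴴ * v = 1 := by rw [hv, extend_conjTranspose, extend_mul, hV1, extend_one]
  set f : Config d → ℂ := (u * v) *ᵥ ψ.ofLp with hf
  have hback : (vᴴ * uᴴ) *ᵥ f = ψ.ofLp := by
    rw [hf, Matrix.mulVec_mulVec, mul_assoc, ← mul_assoc uᴴ, hu1, one_mul, hv1, Matrix.one_mulVec]
  obtain ⟨I, J, hI, hJ, hI', hJ', b, hb⟩ := exists_isVirtualBasis_of_diagonal h f P Q (by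
    intro a a' c c'
    have hEA : extend A (Matrix.single a a' (1 : ℂ)) ∈ localOps d A := extend_mem_localOps _ _
    have hEC : extend C (Matrix.single c c' (1 : ℂ)) ∈ localOps d C := extend_mem_localOps _ _
    rw [← h.star_dotProduct_single_mulVec]
    refine (expect_conj ψ _ (u * v)).trans ?_
    have e : (u * v)ᴴ * (extend A (Matrix.single a a' 1) * extend C (Matrix.single c c' 1)) *
        (u * v) = extend A (Uᴴ * Matrix.single a a' 1 * U) *
          extend C (Vᴴ * Matrix.single c c' 1 * V) := by
      simp only [← extend_mul, ← extend_conjTranspose, ← hu, ← hv]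
      generalize extend A (Matrix.single a a' (1 : ℂ)) = X at *
      generalize extend C (Matrix.single c c' (1 : ℂ)) = Y at *
      have hXu : uᴴ * X * u ∈ localOps d A := mul_mem (mul_mem huA' hEA) huA
      calc (u * v)ᴴ * (X * Y) * (u * v) = vᴴ * (uᴴ * X * (Y * u)) * v := by
            rw [Matrix.conjTranspose_mul]
            simp only [mul_assoc]
        _ = vᴴ * (uᴴ * X * u) * Y * v := by
            rw [← localOps_commute h.disjoint huA hEC]
            simp only [mul_assoc]
        _ = (uᴴ * X * u) * (vᴴ * Y * v) := by
            rw [← localOps_commute h.disjoint hXu hvC']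
            simp only [mul_assoc]
    rw [e, hcl _ (extend_mem_localOps _ _) _ (extend_mem_localOps _ _), hP, hQ]
    by_cases ha : a = a' <;> by_cases hc : c = c' <;> simp [ha, hc, mul_pow])
  -- The rotations act on `A` and `C`, hence commute with operators on `p`. The basis found for the
  -- rotated vector `f` therefore serves `ψ`, with mirrors conjugated by `u` or `v`.
  have hcomm : ∀ X ∈ localOps d p, X *ᵥ ψ.ofLp = (vᴴ * uᴴ) *ᵥ (X *ᵥ f) := by
    intro X hX
    rw [← hback, ← Matrix.mulVec_mulVec, ← Matrix.mulVec_mulVec,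
      localOps_mulVec_comm h.disjoint_right.symm hX hvC',
      localOps_mulVec_comm h.disjoint_left.symm hX huA']
  have hfX : ∀ X : Op d, (vᴴ * uᴴ) *ᵥ (X *ᵥ f) = (vᴴ * uᴴ * (X * (u * v))) *ᵥ ψ.ofLp := by
    intro X
    rw [hf, Matrix.mulVec_mulVec, Matrix.mulVec_mulVec, mul_assoc]
  clear_value f
  refine ⟨I, J, hI, hJ, hI', hJ', b, hb.orthonormal, ?_, ?_, ?_⟩
  · rw [hcomm _ (sum_mem fun i _ => sum_mem fun j _ => matUnit_mem b i j i j), hb.sum_mulVec, hback]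
  · intro i i'
    obtain ⟨Y, hY, hYf⟩ := hb.mirror_left i i'
    refine ⟨uᴴ * Y * u, mul_mem (mul_mem huA' hY) huA, ?_⟩
    rw [hcomm _ (sum_mem fun j _ => matUnit_mem b i j i' j), hYf, hfX]
    have := localOps_commute h.disjoint (mul_mem (mul_mem huA' hY) huA) hvC'
    refine congrArg (· *ᵥ ψ.ofLp) ?_
    calc vᴴ * uᴴ * (Y * (u * v)) = vᴴ * (uᴴ * Y * u) * v := by simp only [mul_assoc]
      _ = uᴴ * Y * u := by rw [← this, mul_assoc, hv1, mul_one]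
  · intro j j'
    obtain ⟨Y, hY, hYf⟩ := hb.mirror_right j j'
    refine ⟨vᴴ * Y * v, mul_mem (mul_mem hvC' hY) hvC, ?_⟩
    rw [hcomm _ (sum_mem fun i _ => matUnit_mem b i j i j'), hYf, hfX]
    refine congrArg (· *ᵥ ψ.ofLp) ?_
    calc vᴴ * uᴴ * (Y * (u * v)) = vᴴ * (uᴴ * Y * u) * v := by simp only [mul_assoc]
      _ = vᴴ * Y * v := by
        rw [mul_assoc uᴴ, ← localOps_commute h.disjoint huA hY,
          ← mul_assoc uᴴ u, hu1, one_mul]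

/-! ### Cooling maps -/

/-- Matrix units `e` for a pair of virtual subsystems of `P`, and operators `m` on `P` that reset
the first of them, do not disturb the projections of neighborhoods other than `S`, and form a
channel on `P` for each value of the first index. -/
structure IsCooling (N : NeighborhoodStructure n) (ψ : Hilb d) (S P : Finset (Fin n))
    {I J K : Type} [Fintype I] [Fintype J] [Fintype K] [DecidableEq I] [DecidableEq J]
    (e : I → J → I → J → Op d) (m : I → K → Op d) : Prop where
  e_mem : ∀ i j k l, e i j k l ∈ localOps d P
  e_mul : ∀ i j k l k' l' i' j', e i j k l * e k' l' i' j' =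
    if k = k' then if l = l' then e i j i' j' else 0 else 0
  e_conj : ∀ i j k l, (e i j k l)ᴴ = e k l i j
  e_minimal : ∀ X ∈ localOps d P, ∀ i j k l, ∃ c : ℂ, e i j i j * X * e k l k l = c • e i j k l
  sum_mulVec : (∑ i, ∑ j, e i j i j) *ᵥ ψ.ofLp = ψ.ofLp
  e_preserves : ∀ j j', nbhdProj S ψ * ((∑ i, e i j i j') * nbhdProj S ψ) =
    (∑ i, e i j i j') * nbhdProj S ψ
  m_mem : ∀ i k, m i k ∈ localOps d P
  m_orthogonal : ∀ i i' k, i ≠ i' → (m i k)ᴴ * m i' k = 0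
  m_sum : ∀ i, ∑ k, (m i k)ᴴ * m i k = 1
  m_preserves : ∀ T ∈ N.nbhds, T ≠ S → ∀ i k,
    nbhdProj T ψ * (m i k * nbhdProj T ψ) = m i k * nbhdProj T ψ
  m_eq : ∀ i i' k, m i k = (∑ j, e i j i' j) * m i' k

/-- There are matrix units and resetting operators on `P` as in `IsCooling`. -/
def HasCooling (N : NeighborhoodStructure n) (ψ : Hilb d) (S P : Finset (Fin n)) : Prop :=
  ∃ (I J K : Type) (_ : Fintype I) (_ : Fintype J) (_ : Fintype K) (_ : DecidableEq I)
    (_ : DecidableEq J) (e : I → J → I → J → Op d) (m : I → K → Op d), IsCooling N ψ S P e m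

theorem hasCooling_empty (N : NeighborhoodStructure n) (ψ : Hilb d) (S : Finset (Fin n)) :
    HasCooling N ψ S ∅ := by
  refine ⟨Unit, Unit, Unit, inferInstance, inferInstance, inferInstance, inferInstance,
    inferInstance, fun _ _ _ _ => 1, fun _ _ => 1, ?_⟩
  constructor
  · exact fun _ _ _ _ => one_mem _
  · simp
  · simp
  · intro X hX i j k l
    obtain ⟨c, rfl⟩ := localOps_empty hX
    exact ⟨c, by simp⟩
  · simp
  · simp [nbhdProj_mul_self]
  · exact fun _ _ => one_mem _
  · exact fun i i' _ h => absurd (Subsingleton.elim i i') h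
  · simp
  · simp [nbhdProj_mul_self]
  · simp

theorem sum_prod_mul {I J : Type*} [Fintype I] [Fintype J] (F : I → Op d) (G : J → Op d) :
    ∑ x : I × J, F x.1 * G x.2 = (∑ i, F i) * ∑ j, G j := by
  rw [Fintype.sum_prod_type, Finset.sum_mul_sum]

/-- Operators on disjoint parts commute, so all the data are tensor products. Only minimality needs
operators on the union that are not products, and it is linear in them. -/
theorem HasCooling.union {N : NeighborhoodStructure n} {ψ : Hilb d} {S P P' : Finset (Fin n)}
    (hdis : Disjoint P P') (h : HasCooling N ψ S P) (h' : HasCooling N ψ S P') :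
    HasCooling N ψ S (P ∪ P') := by
  obtain ⟨I, J, K, _, _, _, _, _, e, m, h⟩ := h
  obtain ⟨I', J', K', _, _, _, _, _, e', m', h'⟩ := h'
  have hP : ∀ {X}, X ∈ localOps d P → X ∈ localOps d (P ∪ P') := fun hX =>
    localOps_mono Finset.subset_union_left hX
  have hP' : ∀ {X}, X ∈ localOps d P' → X ∈ localOps d (P ∪ P') := fun hX =>
    localOps_mono Finset.subset_union_right hX
  have swap : ∀ {X Y Z W : Op d}, Y ∈ localOps d P' → Z ∈ localOps d P →
      (X * Y) * (Z * W) = (X * Z) * (Y * W) := by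
    intro X Y Z W hY hZ
    rw [mul_assoc, ← mul_assoc Y, localOps_commute hdis.symm hY hZ]
    simp only [mul_assoc]
  refine ⟨I × I', J × J', K × K', inferInstance, inferInstance, inferInstance, inferInstance,
    inferInstance, fun i j k l => e i.1 j.1 k.1 l.1 * e' i.2 j.2 k.2 l.2,
    fun i k => m i.1 k.1 * m' i.2 k.2, ?_⟩
  constructor
  · exact fun i j k l => mul_mem (hP (h.e_mem _ _ _ _)) (hP' (h'.e_mem _ _ _ _))
  · intro i j k l k' l' i' j'
    rw [swap (h'.e_mem _ _ _ _) (h.e_mem _ _ _ _), h.e_mul, h'.e_mul]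
    simp only [Prod.ext_iff]
    by_cases h1 : k.1 = k'.1 <;> by_cases h2 : k.2 = k'.2 <;> by_cases h3 : l.1 = l'.1 <;>
      by_cases h4 : l.2 = l'.2 <;> simp [h1, h2, h3, h4]
  · intro i j k l
    rw [Matrix.conjTranspose_mul, h.e_conj, h'.e_conj,
      localOps_commute hdis.symm (h'.e_mem _ _ _ _) (h.e_mem _ _ _ _)]
  · intro X hX i j k l
    have hspan := localOps_union hdis hX
    clear hX
    induction hspan using Submodule.span_induction with
    | mem X hX =>
      obtain ⟨Y, hY, Z, hZ, rfl⟩ := hX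
      obtain ⟨c, hc⟩ := h.e_minimal Y hY i.1 j.1 k.1 l.1
      obtain ⟨c', hc'⟩ := h'.e_minimal Z hZ i.2 j.2 k.2 l.2
      refine ⟨c * c', ?_⟩
      rw [swap (h'.e_mem _ _ _ _) hY, swap (mul_mem (h'.e_mem _ _ _ _) hZ) (h.e_mem _ _ _ _), hc,
        hc', smul_mul_smul_comm]
    | zero => exact ⟨0, by simp⟩
    | add X Y _ _ hX hY =>
      obtain ⟨c, hc⟩ := hX
      obtain ⟨c', hc'⟩ := hY
      exact ⟨c + c', by rw [mul_add, add_mul, hc, hc', add_smul]⟩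
    | smul a X _ hX =>
      obtain ⟨c, hc⟩ := hX
      exact ⟨a * c, by rw [mul_smul_comm, smul_mul_assoc, hc, smul_smul]⟩
  · have : ∑ i : I × I', ∑ j : J × J', e i.1 j.1 i.1 j.1 * e' i.2 j.2 i.2 j.2 =
        (∑ i, ∑ j, e i j i j) * ∑ i, ∑ j, e' i j i j := by
      rw [← sum_prod_mul]
      exact Finset.sum_congr rfl fun i _ =>
        sum_prod_mul (fun j => e i.1 j i.1 j) fun j => e' i.2 j i.2 j
    rw [this, ← Matrix.mulVec_mulVec, h'.sum_mulVec, h.sum_mulVec]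
  · intro j j'
    rw [sum_prod_mul (fun i => e i j.1 i j'.1) fun i => e' i j.2 i j'.2, mul_assoc,
      ← h'.e_preserves, ← mul_assoc _ (nbhdProj S ψ), ← mul_assoc (nbhdProj S ψ), h.e_preserves]
  · exact fun i k => mul_mem (hP (h.m_mem _ _)) (hP' (h'.m_mem _ _))
  · intro i i' k hii
    rw [Matrix.conjTranspose_mul, mul_assoc, ← mul_assoc (m i.1 k.1)ᴴ]
    by_cases h1 : i.1 = i'.1
    · have h2 : i.2 ≠ i'.2 := fun h2 => hii (Prod.ext h1 h2)
      rw [← mul_assoc, localOps_commute hdis.symm (conjTranspose_mem_localOps (h'.m_mem _ _))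
        (mul_mem (conjTranspose_mem_localOps (h.m_mem _ _)) (h.m_mem _ _)), mul_assoc,
        h'.m_orthogonal _ _ _ h2, mul_zero]
    · rw [h.m_orthogonal _ _ _ h1, zero_mul, mul_zero]
  · intro i
    have : ∀ k : K × K', (m i.1 k.1 * m' i.2 k.2)ᴴ * (m i.1 k.1 * m' i.2 k.2) =
        ((m i.1 k.1)ᴴ * m i.1 k.1) * ((m' i.2 k.2)ᴴ * m' i.2 k.2) := by
      intro k
      rw [Matrix.conjTranspose_mul, ← localOps_commute hdis
        (conjTranspose_mem_localOps (h.m_mem _ _)) (conjTranspose_mem_localOps (h'.m_mem _ _)),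
        swap (conjTranspose_mem_localOps (h'.m_mem _ _)) (h.m_mem _ _)]
    rw [Finset.sum_congr rfl fun k _ => this k,
      sum_prod_mul (fun k => (m i.1 k)ᴴ * m i.1 k) fun k => (m' i.2 k)ᴴ * m' i.2 k, h.m_sum,
      h'.m_sum, one_mul]
  · intro T hT hTS i k
    rw [mul_assoc, ← h'.m_preserves T hT hTS, ← mul_assoc _ (nbhdProj T ψ),
      ← mul_assoc (nbhdProj T ψ), h.m_preserves T hT hTS]
  · intro i i' k
    rw [sum_prod_mul (fun j => e i.1 j i'.1 j) fun j => e' i.2 j i'.2 j,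
      swap (sum_mem fun j _ => h'.e_mem _ _ _ _) (h.m_mem _ _), ← h.m_eq, ← h'.m_eq]

/-- A cooling of the whole neighborhood `S` gives Kraus operators that map into the range of `Π_S`
and preserve the ranges of the other projections. -/
theorem HasCooling.exists_kraus {N : NeighborhoodStructure n} {ψ : Hilb d} (hψ : ‖ψ‖ = 1)
    {S : Finset (Fin n)} (h : HasCooling N ψ S S) :
    ∃ (K : Type) (_ : Fintype K) (M : K → Op d), (∀ k, M k ∈ localOps d S) ∧
      ∑ k, (M k)ᴴ * M k = 1 ∧ (∀ k, nbhdProj S ψ * M k = M k) ∧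
      ∀ T ∈ N.nbhds, T ≠ S → ∀ k, nbhdProj T ψ * (M k * nbhdProj T ψ) = M k * nbhdProj T ψ := by
  obtain ⟨I, J, K, _, _, _, _, _, e, m, h⟩ := h
  set R := nbhdProj S ψ with hR
  have hψ0 : ψ.ofLp ≠ 0 := by
    intro h0
    have := star_dotProduct_self ψ hψ
    simp [h0] at this
  -- A value of the second index that carries weight in `ψ`.
  obtain ⟨j₀, hj₀⟩ : ∃ j, (∑ i, e i j i j) *ᵥ ψ.ofLp ≠ 0 := by
    by_contra! hall
    refine hψ0 ?_
    rw [← h.sum_mulVec, Finset.sum_comm, Matrix.sum_mulVec]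
    exact Finset.sum_eq_zero fun j _ => hall j
  set q := ∑ i, e i j₀ i j₀ with hq
  have hqR : q * R = R * q := by
    have h1 := h.e_preserves j₀ j₀
    have h2 := congrArg Matrix.conjTranspose h1
    have h3 : qᴴ = q := by
      rw [hq, Matrix.conjTranspose_sum]
      simp only [h.e_conj]
    have h4 : Rᴴ = R := nbhdProj_conjTranspose S ψ
    rw [← hq] at h1 h2
    simp only [Matrix.conjTranspose_mul, h3, ← hR, h4] at h1 h2
    rw [← h1, ← mul_assoc, h2]
  obtain ⟨i₁, hi₁⟩ : ∃ i, R * e i j₀ i j₀ ≠ 0 := by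
    by_contra! hall
    refine hj₀ ?_
    have h1 : q *ᵥ ψ.ofLp = (R * q) *ᵥ ψ.ofLp := by
      rw [← hqR, ← Matrix.mulVec_mulVec, nbhdProj_mulVec_self]
    rw [h1, hq, Finset.mul_sum, Finset.sum_eq_zero fun i _ => hall i, Matrix.zero_mulVec]
  -- On the span of the virtual basis `Π_S` acts only on the first index; `x` is a nonzero column of
  -- that action, hence a vector in its range.
  choose x hx using fun i => h.e_minimal R (nbhdProj_mem S ψ) i j₀ i₁ j₀
  have hu : R * e i₁ j₀ i₁ j₀ = ∑ i, x i • e i j₀ i₁ j₀ := by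
    have h1 : q * e i₁ j₀ i₁ j₀ = e i₁ j₀ i₁ j₀ := by
      simp [hq, Finset.sum_mul, h.e_mul]
    conv_lhs => rw [← h1]
    rw [← mul_assoc, ← hqR, hq, Finset.sum_mul, Finset.sum_mul]
    exact Finset.sum_congr rfl fun i _ => hx i
  obtain ⟨i₂, hi₂⟩ : ∃ i, x i ≠ 0 := by
    by_contra! hall
    exact hi₁ (by rw [hu, Finset.sum_eq_zero fun i _ => by rw [hall i, zero_smul]])
  -- Changing the second index from `j₀` to `j` preserves the range of `Π_S`, so the vector `x`
  -- found at `j₀` works for all `j`.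
  have hfix : ∀ j, R * ∑ i, x i • e i j i₁ j = ∑ i, x i • e i j i₁ j := by
    intro j
    have h1 : ∑ i, x i • e i j i₁ j =
        (∑ i, e i j i j₀) * R * (e i₁ j₀ i₁ j₀ * e i₁ j₀ i₁ j) := by
      rw [mul_assoc, ← mul_assoc R, hu]
      simp [Finset.sum_mul, Finset.mul_sum, h.e_mul]
    rw [h1, ← mul_assoc, h.e_preserves]
  have hfix' : ∀ k, R * ∑ i, x i • m i k = ∑ i, x i • m i k := by
    intro k
    have h1 : ∑ i, x i • m i k = (∑ j, ∑ i, x i • e i j i₁ j) * m i₁ k := by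
      rw [Finset.sum_comm, Finset.sum_mul]
      refine Finset.sum_congr rfl fun i _ => ?_
      rw [← Finset.smul_sum, smul_mul_assoc, ← h.m_eq]
    rw [h1, ← mul_assoc, Finset.mul_sum, Finset.sum_congr rfl fun j _ => hfix j]
  -- By orthogonality of the `m i k` for distinct `i`, the unnormalized operators satisfy `∑ Mᴴ M =
  -- ‖x‖² = s`, whence the factor `1/√s`.
  set s : ℝ := ∑ i, ‖x i‖ ^ 2 with hs
  have hs0 : 0 < s := Finset.sum_pos' (fun i _ => by positivity)
    ⟨i₂, Finset.mem_univ _, by have := norm_pos_iff.2 hi₂; positivity⟩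
  set t : ℂ := ((Real.sqrt s : ℝ) : ℂ)⁻¹ with ht
  refine ⟨K, inferInstance, fun k => t • ∑ i, x i • m i k, fun k => ?_, ?_, fun k => ?_, ?_⟩
  · exact Subalgebra.smul_mem _ (sum_mem fun i _ => Subalgebra.smul_mem _ (h.m_mem i k) _) _
  · have h1 : ∀ k, (∑ i, x i • m i k)ᴴ * ∑ i, x i • m i k =
        ∑ i, (star (x i) * x i) • ((m i k)ᴴ * m i k) := by
      intro k
      rw [Matrix.conjTranspose_sum, Finset.sum_mul]
      refine Finset.sum_congr rfl fun i _ => ?_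
      rw [Finset.mul_sum, Finset.sum_eq_single i]
      · rw [Matrix.conjTranspose_smul, smul_mul_smul_comm]
      · intro i' _ hi'
        rw [Matrix.conjTranspose_smul, smul_mul_smul_comm, h.m_orthogonal _ _ _ hi'.symm, smul_zero]
      · simp
    have h2 : ∑ k, (∑ i, x i • m i k)ᴴ * ∑ i, x i • m i k = (s : ℂ) • 1 := by
      rw [Finset.sum_congr rfl fun k _ => h1 k, Finset.sum_comm, hs, Complex.ofReal_sum,
        Finset.sum_smul]
      refine Finset.sum_congr rfl fun i _ => ?_
      rw [← Finset.smul_sum, h.m_sum, RCLike.star_def, Complex.conj_mul', Complex.ofReal_pow]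
    simp only [Matrix.conjTranspose_smul, smul_mul_smul_comm]
    rw [← Finset.smul_sum, h2, smul_smul, ht, star_inv₀, RCLike.star_def, Complex.conj_ofReal,
      ← mul_inv, ← Complex.ofReal_mul, Real.mul_self_sqrt hs0.le, inv_mul_cancel₀, one_smul]
    exact_mod_cast hs0.ne'
  · rw [mul_smul_comm, hfix']
  · intro T hT hTS k
    simp only [Finset.smul_sum, Finset.sum_mul, Finset.mul_sum, smul_mul_assoc, mul_smul_comm,
      h.m_preserves T hT hTS]

theorem extend_vecMulVec_mul {p : Finset (Fin n)} (u v u' v' : InConfig d p → ℂ) :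
    extend p (Matrix.vecMulVec u (star v)) * extend p (Matrix.vecMulVec u' (star v')) =
      (star v ⬝ᵥ u') • extend p (Matrix.vecMulVec u (star v')) := by
  rw [extend_mul, ← extend_smul, Matrix.vecMulVec_mul_vecMulVec, Matrix.vecMulVec_smul]

theorem extend_vecMulVec_conjTranspose {p : Finset (Fin n)} (u v : InConfig d p → ℂ) :
    (extend p (Matrix.vecMulVec u (star v)))ᴴ = extend p (Matrix.vecMulVec v (star u)) := by
  rw [extend_conjTranspose, Matrix.conjTranspose_vecMulVec, star_star]

/-- A virtual basis of the coarse-grained subsystem `p` of `S` gives a cooling of `p`: the part of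
`p` outside the support of `ψ` is reset to a vector of the virtual basis. -/
theorem hasCooling_of_isVirtualBasis {N : NeighborhoodStructure n} {ψ : Hilb d} (hψ : ‖ψ‖ = 1)
    {S A p C : Finset (Fin n)} (hsep : N.Separates S A p C) (hpS : p ⊆ S) {I J : Type} [Fintype I]
    [Fintype J] [DecidableEq I] [DecidableEq J] {b : I → J → InConfig d p → ℂ}
    (hb : IsVirtualBasis A C ψ.ofLp b) : HasCooling N ψ S p := by
  have hmul : ∀ i j k l k' l' i' j', matUnit b i j k l * matUnit b k' l' i' j' =
      if k = k' then if l = l' then matUnit b i j i' j' else 0 else 0 := by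
    intro i j k l k' l' i' j'
    rw [matUnit, matUnit, extend_vecMulVec_mul, hb.orthonormal, ite_smul, one_smul, zero_smul,
      ite_and]
    rfl
  have hconj : ∀ i j k l, (matUnit b i j k l)ᴴ = matUnit b k l i j := fun i j k l =>
    extend_vecMulVec_conjTranspose _ _
  obtain ⟨j₀⟩ : Nonempty J := by
    by_contra hJ
    rw [not_nonempty_iff] at hJ
    have h1 := hb.sum_mulVec
    simp only [Finset.univ_eq_empty, Finset.sum_empty, Finset.sum_const_zero,
      Matrix.zero_mulVec] at h1
    have h2 := star_dotProduct_self ψ hψ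
    simp [← h1] at h2
  set q : Matrix (InConfig d p) (InConfig d p) ℂ :=
    1 - ∑ i, ∑ j, Matrix.vecMulVec (b i j) (star (b i j)) with hq
  have hqb : ∀ i j, q *ᵥ b i j = 0 := by
    intro i j
    rw [hq, Matrix.sub_mulVec, Matrix.one_mulVec, Matrix.sum_mulVec, Finset.sum_eq_single i,
      Matrix.sum_mulVec, Finset.sum_eq_single j]
    · simp [Matrix.vecMulVec_mulVec, hb.orthonormal]
    · intro j' _ hj
      simp [Matrix.vecMulVec_mulVec, hb.orthonormal, hj]
    · simp
    · intro i' _ hi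
      rw [Matrix.sum_mulVec]
      refine Finset.sum_eq_zero fun j' _ => ?_
      simp [Matrix.vecMulVec_mulVec, hb.orthonormal, hi]
    · simp
  have hqconj : qᴴ = q := by
    rw [hq, Matrix.conjTranspose_sub, Matrix.conjTranspose_one, Matrix.conjTranspose_sum]
    simp only [Matrix.conjTranspose_sum, Matrix.conjTranspose_vecMulVec, star_star]
  have hqq : q * q = q := by
    conv_lhs => rw [hq]
    have : ∀ i j, Matrix.vecMulVec (b i j) (star (b i j)) * q = 0 := by
      intro i j
      rw [Matrix.vecMulVec_mul]
      have h1 := congrArg star (hqb i j)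
      rw [Matrix.star_mulVec, hqconj, star_zero] at h1
      rw [h1]
      simp
    rw [← hq, sub_mul, one_mul, Finset.sum_mul]
    simp only [Finset.sum_mul, this, Finset.sum_const_zero, sub_zero]
  have hqE : extend p q = 1 - ∑ i, ∑ j, matUnit b i j i j := by
    have h1 : q + ∑ i, ∑ j, Matrix.vecMulVec (b i j) (star (b i j)) = 1 := sub_add_cancel _ _
    have h2 := congrArg (extend p) h1
    rw [extend_add, extend_one, extend_sum] at h2
    simp only [extend_sum] at h2
    exact eq_sub_of_add_eq h2
  -- The columns of `q`, the projection onto the orthogonal complement of the virtual basis; their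
  -- rank-one operators sum to `q`.
  let g : InConfig d p → InConfig d p → ℂ := fun x y => q y x
  have hgb : ∀ x i j, star (g x) ⬝ᵥ b i j = 0 := by
    intro x i j
    have h1 := congrFun (hqb i j) x
    rw [← hqconj] at h1
    exact h1
  have hgsum : ∑ x, Matrix.vecMulVec (g x) (star (g x)) = q := by
    ext y z
    conv_rhs => rw [← hqq]
    rw [Matrix.sum_apply, Matrix.mul_apply]
    refine Finset.sum_congr rfl fun x _ => ?_
    rw [Matrix.vecMulVec_apply]
    congr 1
    conv_rhs => rw [← hqconj]
    rfl
  -- Resetting to `i`: `inl i'` changes the first index from `i'` to `i` and keeps `j`, which is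
  -- mirrored on `A`. `inr x` moves the complement of the basis to `b i j₀`; it annihilates `ψ`, so
  -- its mirror is `0`.
  let m : I → I ⊕ InConfig d p → Op d := fun i => Sum.elim (fun i' => ∑ j, matUnit b i j i' j)
    fun x => extend p (Matrix.vecMulVec (b i j₀) (star (g x)))
  have hmr : ∀ i x, m i (Sum.inr x) *ᵥ ψ.ofLp = 0 := by
    intro i x
    rw [← hb.sum_mulVec, Matrix.mulVec_mulVec, Finset.mul_sum]
    have : ∀ k l, m i (Sum.inr x) * matUnit b k l k l = 0 := by
      intro k l
      rw [matUnit]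
      refine (extend_vecMulVec_mul _ _ _ _).trans ?_
      rw [hgb, zero_smul]
    simp only [Finset.mul_sum, this, Finset.sum_const_zero, Matrix.zero_mulVec]
  have hm_mem : ∀ i k, m i k ∈ localOps d p := by
    rintro i (i' | x)
    · exact sum_mem fun j _ => matUnit_mem b i j i' j
    · exact extend_mem_localOps _ _
  refine ⟨I, J, I ⊕ InConfig d p, inferInstance, inferInstance, inferInstance, inferInstance,
    inferInstance, matUnit b, m, ?_⟩
  constructor
  · exact matUnit_mem b
  · exact hmul
  · exact hconj
  · rintro _ ⟨X, rfl⟩ i j k l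
    refine ⟨star (b i j) ⬝ᵥ (X *ᵥ b k l), ?_⟩
    rw [mul_assoc, matUnit, matUnit, extend_mul, Matrix.mul_vecMulVec, extend_vecMulVec_mul]
    rfl
  · exact hb.sum_mulVec
  · intro j j'
    obtain ⟨Y, hY, hYψ⟩ := hb.mirror_right j j'
    exact mul_nbhdProj_of_mirror
      ((Finset.disjoint_union_right.2 ⟨hsep.disjoint.symm, hsep.disjoint_right⟩).mono_right
        hsep.mem_subset)
      (localOps_mono hpS (sum_mem fun i _ => matUnit_mem b i j i j')) hY hYψ
  · exact hm_mem
  · rintro i i' (k | x) hii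
    · simp only [m, Sum.elim_inl, Matrix.conjTranspose_sum, hconj, Finset.sum_mul, Finset.mul_sum,
        hmul, if_neg hii, Finset.sum_const_zero]
    · simp only [m, Sum.elim_inr]
      rw [extend_vecMulVec_conjTranspose, extend_vecMulVec_mul, hb.orthonormal,
        if_neg fun h => hii h.1, zero_smul]
  · intro i
    rw [Fintype.sum_sum_type]
    have h1 : ∀ i', (m i (Sum.inl i'))ᴴ * m i (Sum.inl i') = ∑ j, matUnit b i' j i' j := by
      intro i'
      simp [m, Matrix.conjTranspose_sum, hconj, Finset.sum_mul, Finset.mul_sum, hmul]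
    have h2 : ∀ x, (m i (Sum.inr x))ᴴ * m i (Sum.inr x) =
        extend p (Matrix.vecMulVec (g x) (star (g x))) := by
      intro x
      simp only [m, Sum.elim_inr]
      rw [extend_vecMulVec_conjTranspose, extend_vecMulVec_mul, hb.orthonormal,
        if_pos ⟨rfl, rfl⟩, one_smul]
    rw [Finset.sum_congr rfl fun i' _ => h1 i', Finset.sum_congr rfl fun x _ => h2 x,
      ← extend_sum, hgsum, hqE, add_sub_cancel]
  · intro T hT hTS i k
    by_cases hTp : Disjoint T p
    · exact mul_nbhdProj_of_disjoint hTp.symm (hm_mem i k)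
    obtain ⟨hpT, hTC⟩ := hsep.other_subset T hT hTS hTp
    have hAT : Disjoint A T :=
      (Finset.disjoint_union_right.2 ⟨hsep.disjoint_left, hsep.disjoint⟩).mono_right hTC
    obtain k | x := k
    · obtain ⟨Y, hY, hYψ⟩ := hb.mirror_left i k
      exact mul_nbhdProj_of_mirror hAT (localOps_mono hpT (hm_mem i _)) hY hYψ
    · exact mul_nbhdProj_of_mirror hAT (localOps_mono hpT (hm_mem i _)) (zero_mem _)
        (by rw [hmr, Matrix.zero_mulVec])
  · rintro i i' (k | x)
    · simp [m, Finset.sum_mul, Finset.mul_sum, hmul]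
    · simp only [m, Sum.elim_inr, Finset.sum_mul, matUnit, extend_vecMulVec_mul, hb.orthonormal]
      simp

theorem NeighborhoodStructure.Separates.tripartition {N : NeighborhoodStructure n}
    {S A p C : Finset (Fin n)} (h : N.Separates S A p C) : Tripartition A p C :=
  ⟨h.disjoint_left, h.disjoint_right, h.disjoint, h.cover⟩

/-- `S` is the disjoint union of its coarse-grained subsystems. Each is separated, hence carries a
virtual basis and a cooling, and coolings multiply. -/
theorem hasCooling_self {N : NeighborhoodStructure n} (hN : N.IsTreeLike) {ψ : Hilb d}
    (hψ : ‖ψ‖ = 1) (hu : IsUniqueGroundState (N.canonicalHamiltonian ψ) ψ)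
    (hc : N.HasCommutingHamiltonian ψ) {S : Finset (Fin n)} (hS : S ∈ N.nbhds) :
    HasCooling N ψ S S := by
  classical
  have hpart : ∀ a ∈ S, HasCooling N ψ S (N.particle a) := by
    intro a ha
    obtain ⟨A, C, hsep⟩ := hN.exists_separates N hS ha
    have hcl : Clusters ψ A C := clusters_of_commute hψ hu hc fun T hT =>
      (hsep.subset_or T hT).symm.imp
        (Finset.disjoint_union_right.2 ⟨hsep.disjoint_left, hsep.disjoint⟩).mono_right
        (Finset.disjoint_union_right.2 ⟨hsep.disjoint.symm, hsep.disjoint_right⟩).mono_right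
    obtain ⟨I, J, _, _, _, _, b, hb⟩ := exists_isVirtualBasis hsep.tripartition hcl
    exact hasCooling_of_isVirtualBasis hψ hsep (N.particle_subset hS ha) hb
  have hind : ∀ F ⊆ S, HasCooling N ψ S (F.biUnion N.particle) := by
    intro F
    induction F using Finset.induction_on with
    | empty =>
      intro _
      rw [Finset.biUnion_empty]
      exact hasCooling_empty N ψ S
    | insert a F _ ih =>
      intro hF
      have hcool := ih ((Finset.subset_insert a F).trans hF)
      rw [Finset.biUnion_insert]
      by_cases hdis : Disjoint (N.particle a) (F.biUnion N.particle)
      · exact (hpart a (hF (Finset.mem_insert_self a F))).union hdis hcool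
      · obtain ⟨x, hxa, hx⟩ := Finset.not_disjoint_iff.1 hdis
        obtain ⟨c, hcF, hxc⟩ := Finset.mem_biUnion.1 hx
        have hsub : N.particle a ⊆ F.biUnion N.particle := by
          intro y hy
          refine Finset.mem_biUnion.2 ⟨c, hcF, N.mem_particle.2 fun T hT => ?_⟩
          have h1 := N.mem_particle.1 hxa T hT
          have h2 := N.mem_particle.1 hxc T hT
          have h3 := N.mem_particle.1 hy T hT
          tauto
        rwa [Finset.union_eq_right.2 hsub]
  have hS' : S.biUnion N.particle = S := by
    refine Finset.Subset.antisymm (Finset.biUnion_subset.2 fun a ha => N.particle_subset hS ha) ?_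
    exact fun a ha => Finset.mem_biUnion.2 ⟨a, ha, N.self_mem_particle a⟩
  have := hind S (Finset.Subset.refl S)
  rwa [hS'] at this

/-! ### Robust stabilization -/

/-- The operator `X` lives on the range of `Π_S`. -/
def IsSupported (S : Finset (Fin n)) (ψ : Hilb d) (X : Op d) : Prop :=
  nbhdProj S ψ * X = X ∧ X * nbhdProj S ψ = X

/-- The Kraus operators of `exists_kraus` act on both sides of `X`, so what they do to the ranges
holds for both halves of `IsSupported`. -/
theorem exists_cooling_map {N : NeighborhoodStructure n} (hN : N.IsTreeLike) {ψ : Hilb d}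
    (hψ : ‖ψ‖ = 1) (hu : IsUniqueGroundState (N.canonicalHamiltonian ψ) ψ)
    (hc : N.HasCommutingHamiltonian ψ) {S : Finset (Fin n)} (hS : S ∈ N.nbhds) :
    ∃ E : Module.End ℂ (Op d), IsNeighborhoodMap S E ∧ (∀ X, IsSupported S ψ (E X)) ∧
      ∀ T ∈ N.nbhds, ∀ X, IsSupported T ψ X → IsSupported T ψ (E X) := by
  obtain ⟨K, _, M, hmem, hsum, hrange, hpres⟩ := (hasCooling_self hN hψ hu hc hS).exists_kraus hψ
  choose m hm using hmem
  set φ := (Fintype.equivFin K).symm with hφ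
  have hrange' : ∀ k, (M k)ᴴ * nbhdProj S ψ = (M k)ᴴ := by
    intro k
    have := congrArg Matrix.conjTranspose (hrange k)
    rwa [Matrix.conjTranspose_mul, nbhdProj_conjTranspose] at this
  have hpres' : ∀ T ∈ N.nbhds, T ≠ S → ∀ k,
      nbhdProj T ψ * (M k)ᴴ * nbhdProj T ψ = nbhdProj T ψ * (M k)ᴴ := by
    intro T hT hTS k
    have := congrArg Matrix.conjTranspose (hpres T hT hTS k)
    rwa [Matrix.conjTranspose_mul, Matrix.conjTranspose_mul, nbhdProj_conjTranspose] at this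
  let E : Module.End ℂ (Op d) := ∑ k, (LinearMap.mulLeft ℂ (M k)).comp (LinearMap.mulRight ℂ (M k)ᴴ)
  have hE : ∀ X, E X = ∑ k, M k * X * (M k)ᴴ := by
    intro X
    simp [E, LinearMap.sum_apply, mul_assoc]
  have hself : ∀ X, IsSupported S ψ (E X) := by
    intro X
    rw [hE]
    refine ⟨?_, ?_⟩
    · rw [Finset.mul_sum]
      exact Finset.sum_congr rfl fun k _ => by rw [← mul_assoc, ← mul_assoc, hrange]
    · rw [Finset.sum_mul]
      exact Finset.sum_congr rfl fun k _ => by rw [mul_assoc, hrange']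
  refine ⟨E, ⟨Fintype.card K, fun i => m (φ i), fun X => ?_, ?_⟩, hself, fun T hT X hX => ?_⟩
  · rw [hE, ← φ.sum_comp]
    simp only [hm]
  · simp only [hm]
    rw [φ.sum_comp fun k => (M k)ᴴ * M k, hsum]
  · by_cases hTS : T = S
    · exact hTS ▸ hself X
    obtain ⟨h1, h2⟩ := hX
    rw [hE]
    refine ⟨?_, ?_⟩
    · rw [Finset.mul_sum]
      refine Finset.sum_congr rfl fun k _ => ?_
      have h3 : M k * X * (M k)ᴴ = M k * nbhdProj T ψ * X * (M k)ᴴ := by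
        rw [mul_assoc (M k) (nbhdProj T ψ) X, h1]
      rw [h3, ← mul_assoc, ← mul_assoc, hpres T hT hTS]
    · rw [Finset.sum_mul]
      refine Finset.sum_congr rfl fun k _ => ?_
      have h3 : M k * X * (M k)ᴴ = M k * X * (nbhdProj T ψ * (M k)ᴴ) := by
        rw [← mul_assoc, mul_assoc (M k) X (nbhdProj T ψ), h2]
      rw [h3, mul_assoc, hpres' T hT hTS]

/-- Uniqueness makes the range of `X` and that of its adjoint multiples of `ψ`, so `X` is a multiple
of the pure state; the trace fixes the factor, without any positivity. -/
theorem eq_pureState_of_isSupported {N : NeighborhoodStructure n} {ψ : Hilb d} (hψ : ‖ψ‖ = 1)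
    (hu : IsUniqueGroundState (N.canonicalHamiltonian ψ) ψ) {X : Op d}
    (hX : ∀ S ∈ N.nbhds, IsSupported S ψ X) (htr : X.trace = 1) : X = pureState ψ := by
  have hu' := (isUniqueGroundState_iff N ψ hψ).1 hu
  have hone := star_dotProduct_self ψ hψ
  have hcol : ∀ f, X *ᵥ f = (star ψ.ofLp ⬝ᵥ (X *ᵥ f)) • ψ.ofLp := by
    intro f
    obtain ⟨c, hc⟩ := hu' (X *ᵥ f) fun S hS => by rw [Matrix.mulVec_mulVec, (hX S hS).1]
    rw [hc, dotProduct_smul, hone, smul_eq_mul, mul_one]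
  have hXP : X = pureState ψ * X := by
    refine ext_mulVec fun f x => congrFun ?_ x
    rw [← Matrix.mulVec_mulVec, pureState_eq, Matrix.vecMulVec_mulVec]
    rw [op_smul_eq_smul]
    exact hcol f
  obtain ⟨c, hc⟩ := hu' (Xᴴ *ᵥ ψ.ofLp) fun S hS => by
    rw [Matrix.mulVec_mulVec]
    have := congrArg Matrix.conjTranspose (hX S hS).2
    rw [Matrix.conjTranspose_mul, nbhdProj_conjTranspose] at this
    rw [this]
  have hX1 : X = star c • pureState ψ := by
    conv_lhs => rw [hXP]
    have h1 := congrArg star hc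
    rw [Matrix.star_mulVec, Matrix.conjTranspose_conjTranspose, star_smul] at h1
    rw [pureState_eq, Matrix.vecMulVec_mul, h1, Matrix.vecMulVec_smul]
  have h2 := (isDensity_pureState ψ hψ).2
  rw [hX1, Matrix.trace_smul, h2, smul_eq_mul, mul_one] at htr
  rw [hX1, htr, one_smul]

theorem IsNeighborhoodMap.trace_map {S : Finset (Fin n)} {E : Module.End ℂ (Op d)}
    (hE : IsNeighborhoodMap S E) (σ : Op d) : (E σ).trace = σ.trace := by
  have := hE.trace_mul (Finset.disjoint_empty_left S) (one_mem _) σ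
  rwa [one_mul, one_mul] at this

/-- One cooling map per neighborhood: each creates its own support and keeps those already created,
so the order is irrelevant. Invariance of `ψ` follows in the same way, as its image is supported in
every range. -/
theorem isRFTS_of_commute {N : NeighborhoodStructure n} (hN : N.IsTreeLike) {ψ : Hilb d}
    (hψ : ‖ψ‖ = 1) (hu : IsUniqueGroundState (N.canonicalHamiltonian ψ) ψ)
    (hc : N.HasCommutingHamiltonian ψ) : N.IsRFTS (pureState ψ) := by
  choose! E hE hself hpres using fun S (hS : S ∈ N.nbhds) => exists_cooling_map hN hψ hu hc hS
  set φ := N.nbhds.equivFin.symm with hφ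
  have hmem : ∀ t, (φ t : Finset (Fin n)) ∈ N.nbhds := fun t => (φ t).2
  refine ⟨N.nbhds.card, fun t => E (φ t), fun t => ⟨φ t, hmem t, hE _ (hmem t)⟩, fun t => ?_,
    fun π σ hσ => ?_⟩
  · refine eq_pureState_of_isSupported hψ hu (fun S hS => hpres _ (hmem t) S hS _ ⟨?_, ?_⟩) ?_
    · rw [pureState_eq, Matrix.mul_vecMulVec, nbhdProj_mulVec_self]
    · have := congrArg star (nbhdProj_mulVec_self S ψ)
      rw [Matrix.star_mulVec, nbhdProj_conjTranspose] at this
      rw [pureState_eq, Matrix.vecMulVec_mul, this]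
    · rw [(hE _ (hmem t)).trace_map, (isDensity_pureState ψ hψ).2]
  · have key : ∀ l : List (Fin N.nbhds.card),
        (∀ t ∈ l, IsSupported (φ t) ψ ((l.map fun t => E (φ t)).prod σ)) ∧
          ((l.map fun t => E (φ t)).prod σ).trace = 1 := by
      intro l
      induction l with
      | nil => exact ⟨by simp, by simpa using hσ.2⟩
      | cons s l ih =>
        rw [List.map_cons, List.prod_cons, Module.End.mul_apply]
        refine ⟨fun t ht => ?_, by rw [(hE _ (hmem s)).trace_map, ih.2]⟩
        rcases List.mem_cons.1 ht with rfl | ht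
        · exact hself _ (hmem t) _
        · exact hpres _ (hmem s) _ (hmem t) _ (ih.1 t ht)
    have hl : (List.ofFn fun t => E (φ (π t))) = (List.ofFn π).map fun t => E (φ t) := by
      rw [List.map_ofFn]
      rfl
    obtain ⟨h1, h2⟩ := key (List.ofFn π)
    rw [← hl] at h1 h2
    refine eq_pureState_of_isSupported hψ hu (fun S hS => ?_) h2
    have := h1 (φ.symm ⟨S, hS⟩) (List.mem_ofFn.2 (π.surjective _))
    rwa [Equiv.apply_symm_apply] at this

end QL

theorem mainTheorem2 {n : ℕ} (d : Fin n → ℕ) (N : QL.NeighborhoodStructure n)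
    (hN : N.IsTreeLike) (ψ : QL.Hilb d) (hψ : ‖ψ‖ = 1) :
    N.IsRFTS (QL.pureState ψ) ↔
      (QL.IsUniqueGroundState (N.canonicalHamiltonian ψ) ψ ∧ N.HasCommutingHamiltonian ψ) :=
  ⟨fun h => ⟨h.isUniqueGroundState hψ, h.hasCommutingHamiltonian hN hψ⟩,
    fun h => QL.isRFTS_of_commute hN hψ h.1 h.2⟩
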